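/- Let $n,p$ be natural numbers, let $\lambda>0$, and let $\boldsymbol{Y}$ be a random $n\times p$ real matrix whose column-wise vectorization satisfies $\mathrm{vec}(\boldsymbol{Y})\sim\mathcal{N}(\boldsymbol{\beta},\boldsymbol{\Gamma})$, where the $np\times np$ covariance matrix $\boldsymbol{\Gamma}$ is invertible. **Clusterings.** For $j\in\{1,\dots,p\}$ let $\widehat{\boldsymbol{B}}_{.j}$ be the minimizer over $B\in\mathbb{R}^n$ of $$\tfrac12\|B-\boldsymbol{Y}_{.j}\|_2^2+\lambda\sum_{1\le i<i'\le n}|B_{i'}-B_i| ,$$ and let the clustering given by $\widehat{\boldsymbol{B}}_{.j}$ be the partition of $\{1,\dots,n\}$ into the level sets of $i\mapsto\widehat{B}_{ij}$. For $1\le K\le n$ let $\mathcal{T}_{K,n}$ be the set of integer sequences $0=t_0<t_1<\dots<t_K=n$. For $\mathbf{t}\in\mathcal{T}_{K,n}$ and a permutation $\sigma$ of $\{1,\dots,n\}$, let $\mathcal{C}(\mathbf{t},\sigma)$ be the clustering with clusters $\{\sigma(t_{k-1}+1),\dots,\sigma(t_k)\}$, $1\le k\le K$, and put $n_k=t_k-t_{k-1}$.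 **Polyhedron.** Let $\mathbf{P}_\sigma x=(x_{\sigma(1)},\dots,x_{\sigma(n)})^\top$, and let $\mathbf{M}(\mathbf{t})\in\mathbb{R}^{2(n-1)\times n}$, $\mathbf{m}(\mathbf{t})\in\mathbb{R}^{2(n-1)}$ be such that the inequalities $\mathbf{M}(\mathbf{t})u\le\lambda\mathbf{m}(\mathbf{t})$ are, row by row, $$-u_i+u_{i+1}\le 0\quad(1\le i\le n-1),$$ $$-\frac1{n_k}\sum_{i=1}^{n_k}u_{t_{k-1}+i}+\frac1{n_{k+1}}\sum_{i=1}^{n_{k+1}}u_{t_k+i}\le-\lambda(t_{k+1}-t_{k-1})\quad(1\le k\le K-1),$$ $$\frac1\ell\sum_{i=1}^{\ell}u_{t_{k-1}+i}-\frac1{n_k}\sum_{i=1}^{n_k}u_{t_{k-1}+i}\le\lambda(n_k-\ell)\quad(1\le k\le K,\ 1\le\ell\le n_k-1).$$ Given permutations $\sigma^{(1)},\dots,\sigma^{(p)}$, integers $K^{(j)}\in\{1,\dots,n\}$ and $\mathbf{t}^{(j)}\in\mathcal{T}_{K^{(j)},n}$, let $\boldsymbol{\mathscr{M}}$ be the block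 diagonal matrix with blocks $\mathbf{M}(\mathbf{t}^{(j)})$, let $\mathbf{D}_\sigma$ be the block diagonal matrix with blocks $\mathbf{P}_{\sigma^{(j)}}$, let $\boldsymbol{\mathscr{m}}$ be the vectors $\mathbf{m}(\mathbf{t}^{(j)})$ stacked, and set $\mathbf{A}=\boldsymbol{\mathscr{M}}\mathbf{D}_\sigma$. **p-value.** For a nonzero $\boldsymbol{\kappa}\in\mathbb{R}^{np}$ put $\boldsymbol{c}=\boldsymbol{\Gamma}\boldsymbol{\kappa}(\boldsymbol{\kappa}^\top\boldsymbol{\Gamma}\boldsymbol{\kappa})^{-1}$ and, for $\mathbf{y}\in\mathbb{R}^{n\times p}$, $\boldsymbol{z}=[\boldsymbol{I}_{np}-\boldsymbol{c}\boldsymbol{\kappa}^\top]\mathrm{vec}(\mathbf{y})$, $$\mathcal{V}^-=\max_{l:(\mathbf{A}\boldsymbol{c})_l<0}\frac{\lambda\mathscr{m}_l-(\mathbf{A}\boldsymbol{z})_l}{(\mathbf{A}\boldsymbol{c})_l},\qquad \mathcal{V}^+=\min_{l:(\mathbf{A}\boldsymbol{c})_l>0}\frac{\lambda\mathscr{m}_l-(\mathbf{A}\boldsymbol{z})_l}{(\mathbf{A}\boldsymbol{c})_l},$$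 with $\max\emptyset=-\infty$ and $\min\emptyset=+\infty$. Let $T(\mathbf{y})$ be the value at $\boldsymbol{\kappa}^\top\mathrm{vec}(\mathbf{y})$ of the cumulative distribution function of the Gaussian distribution $\mathcal{N}(0,\boldsymbol{\kappa}^\top\boldsymbol{\Gamma}\boldsymbol{\kappa})$ truncated to $[\mathcal{V}^-,\mathcal{V}^+]$, and let $\mathrm{pval}(\mathbf{y})=2\min[T(\mathbf{y}),1-T(\mathbf{y})]$. **Statement.** Fix $\sigma^{(j)}$, $K^{(j)}\in\{1,\dots,n\}$ and $\mathbf{t}^{(j)}\in\mathcal{T}_{K^{(j)},n}$ for $j\in\{1,\dots,p\}$, and a nonrandom nonzero vector $\boldsymbol{\kappa}\in\mathbb{R}^{np}$ (which may depend on $(\mathbf{t}^{(j)},\sigma^{(j)})_{j}$) such that $\boldsymbol{\kappa}^\top\boldsymbol{\beta}=0$. Assume that the event $$E=\left\{\text{for all } j,\ \mathcal{C}(\mathbf{t}^{(j)},\sigma^{(j)})\text{ is the clustering given by }\widehat{\boldsymbol{B}}_{.j}\text{ and }Y_{\sigma^{(j)}(1)j}\ge\dots\ge Y_{\sigma^{(j)}(n)j}\right\}$$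 has nonzero probability. Then, conditionally to $E$, $\mathrm{pval}(\boldsymbol{Y})$ is uniformly distributed on $[0,1]$. -/

import Mathlib

open MeasureTheory ProbabilityTheory
open scoped Matrix

noncomputable section

namespace ConvexClustering

/-! ### The one-dimensional convex clustering problem -/

/-- The criterion `½ ‖B - x‖² + lam ∑_{i < i'} |B i' - B i|`. -/
def objective {n : ℕ} (lam : ℝ) (x B : Fin n → ℝ) : ℝ :=
  (1 / 2) * ∑ i, (B i - x i) ^ 2 + lam * ∑ i, ∑ i' ∈ Finset.Ioi i, |B i' - B i|

/-- `B` belongs to the argmin of the criterion. -/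
def IsSolution {n : ℕ} (lam : ℝ) (x B : Fin n → ℝ) : Prop :=
  ∀ B' : Fin n → ℝ, objective lam x B ≤ objective lam x B'

theorem continuous_objective {n : ℕ} (lam : ℝ) (x : Fin n → ℝ) :
    Continuous (objective lam x) := by
  unfold objective
  fun_prop

theorem exists_isSolution {n : ℕ} {lam : ℝ} (hlam : 0 < lam) (x : Fin n → ℝ) :
    ∃ B, IsSolution lam x B := by
  refine (continuous_objective lam x).exists_forall_le' x ?_
  set C : ℝ := objective lam x x with hC
  have hC0 : 0 ≤ C := by
    rw [hC]; unfold objective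
    have : 0 ≤ ∑ i, ∑ i' ∈ Finset.Ioi i, |x i' - x i| := by positivity
    have h2 : 0 ≤ lam * ∑ i, ∑ i' ∈ Finset.Ioi i, |x i' - x i| := by positivity
    simpa using h2
  have hev := (isCompact_closedBall x (Real.sqrt (2 * C))).compl_mem_cocompact
  filter_upwards [hev] with B hB
  by_contra hlt
  push Not at hlt
  apply hB
  rw [Metric.mem_closedBall, dist_pi_le_iff (Real.sqrt_nonneg _)]
  intro i
  rw [Real.dist_eq]
  apply Real.abs_le_sqrt
  have h1 : (B i - x i) ^ 2 ≤ ∑ i, (B i - x i) ^ 2 :=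
    Finset.single_le_sum (f := fun i => (B i - x i) ^ 2) (fun i _ => sq_nonneg _)
      (Finset.mem_univ i)
  have h2 : 0 ≤ lam * ∑ i, ∑ i' ∈ Finset.Ioi i, |B i' - B i| := by positivity
  unfold objective at hlt
  linarith

theorem IsSolution.unique {n : ℕ} {lam : ℝ} (hlam : 0 < lam) {x B₁ B₂ : Fin n → ℝ}
    (h₁ : IsSolution lam x B₁) (h₂ : IsSolution lam x B₂) : B₁ = B₂ := by
  have hm := h₁ (fun i => (B₁ i + B₂ i) / 2)
  have hm' := h₂ (fun i => (B₁ i + B₂ i) / 2)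
  have hq : ∑ i, ((B₁ i + B₂ i) / 2 - x i) ^ 2
      = (∑ i, (B₁ i - x i) ^ 2) / 2 + (∑ i, (B₂ i - x i) ^ 2) / 2
        - (∑ i, (B₁ i - B₂ i) ^ 2) / 4 := by
    rw [Finset.sum_div, Finset.sum_div, Finset.sum_div, ← Finset.sum_add_distrib,
      ← Finset.sum_sub_distrib]
    exact Finset.sum_congr rfl fun i _ => by ring
  have ha : ∑ i, ∑ i' ∈ Finset.Ioi i, |(B₁ i' + B₂ i') / 2 - (B₁ i + B₂ i) / 2|
      ≤ (∑ i, ∑ i' ∈ Finset.Ioi i, |B₁ i' - B₁ i|) / 2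
        + (∑ i, ∑ i' ∈ Finset.Ioi i, |B₂ i' - B₂ i|) / 2 := by
    rw [Finset.sum_div, Finset.sum_div, ← Finset.sum_add_distrib]
    refine Finset.sum_le_sum fun i _ => ?_
    rw [Finset.sum_div, Finset.sum_div, ← Finset.sum_add_distrib]
    refine Finset.sum_le_sum fun i' _ => ?_
    have h := abs_add_le ((B₁ i' - B₁ i) / 2) ((B₂ i' - B₂ i) / 2)
    rw [abs_div, abs_div, abs_two] at h
    have e : (B₁ i' + B₂ i') / 2 - (B₁ i + B₂ i) / 2
        = (B₁ i' - B₁ i) / 2 + (B₂ i' - B₂ i) / 2 := by ring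
    rw [e]
    exact h
  have ha' := mul_le_mul_of_nonneg_left ha hlam.le
  have hz : ∑ i, (B₁ i - B₂ i) ^ 2 ≤ 0 := by
    unfold objective at hm hm'
    rw [hq] at hm hm'
    linarith
  have hz' := (Finset.sum_eq_zero_iff_of_nonneg (fun i _ => sq_nonneg (B₁ i - B₂ i))).1
    (le_antisymm hz (Finset.sum_nonneg fun i _ => sq_nonneg _))
  funext i
  have := hz' i (Finset.mem_univ i)
  exact sub_eq_zero.1 (pow_eq_zero_iff two_ne_zero |>.1 this)

/-- The solution of the one-dimensional convex clustering problem with data `x`. It is the unique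
minimizer of the criterion when `lam > 0`, see `solution_spec` and `IsSolution.unique`. -/
def solution {n : ℕ} (lam : ℝ) (x : Fin n → ℝ) : Fin n → ℝ :=
  Classical.epsilon (IsSolution lam x)

theorem solution_spec {n : ℕ} {lam : ℝ} (hlam : 0 < lam) (x : Fin n → ℝ) :
    IsSolution lam x (solution lam x) :=
  Classical.epsilon_spec (exists_isSolution hlam x)

/-! ### Clusterings -/

/-- The clustering associated with `B`: the clusters are the level sets of `B`. -/
def clusteringOf {n : ℕ} (B : Fin n → ℝ) : Set (Set (Fin n)) :=
  Set.range fun i₀ : Fin n => {i | B i = B i₀}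

/-- The set `𝒯_{K,n}` of sequences of right-limits `0 = t₀ < t₁ < ⋯ < t_K = n`. -/
def rightLimits (K n : ℕ) : Set (Fin (K + 1) → ℕ) :=
  {t | t 0 = 0 ∧ StrictMono t ∧ t (Fin.last K) = n}

/-- The cardinality `n_k = t_k - t_{k-1}` of a cluster; the clusters `1, …, K` are indexed here
by `k = 0, …, K - 1`. -/
def clusterCard {K : ℕ} (t : Fin (K + 1) → ℕ) (k : Fin K) : ℕ :=
  t k.succ - t k.castSucc

/-- The cluster `{σ (t_{k-1} + 1), …, σ (t_k)}`; positions are numbered from `0` here, so that it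
consists of the `σ l` with `t_{k-1} ≤ l < t_k`. -/
def cluster {n K : ℕ} (t : Fin (K + 1) → ℕ) (σ : Equiv.Perm (Fin n)) (k : Fin K) :
    Set (Fin n) :=
  {i | ∃ l : Fin n, t k.castSucc ≤ l ∧ (l : ℕ) < t k.succ ∧ σ l = i}

/-- The clustering `𝒞(t, σ)`. -/
def clusteringOfOrder {n K : ℕ} (t : Fin (K + 1) → ℕ) (σ : Equiv.Perm (Fin n)) :
    Set (Set (Fin n)) :=
  Set.range (cluster t σ)

/-! ### The polyhedron of one variable -/

/-- The matrix `M₁`, with rows `(0, …, 0, -1, 1, 0, …, 0)`. -/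
def M₁ (n : ℕ) : Matrix (Fin (n - 1)) (Fin n) ℝ :=
  Matrix.of fun r l =>
    if (l : ℕ) = r then -1 else if (l : ℕ) = r + 1 then 1 else 0

/-- The matrix `M₂(t)`: its `k`-th row has the entries `-1 / n_k` on the positions of the `k`-th
cluster and `1 / n_{k+1}` on those of the next one. -/
def M₂ (n : ℕ) {K : ℕ} (t : Fin (K + 1) → ℕ) : Matrix (Fin (K - 1)) (Fin n) ℝ :=
  Matrix.of fun k l =>
    if t ⟨k, by omega⟩ ≤ l ∧ (l : ℕ) < t ⟨k + 1, by omega⟩ then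
      -(1 / (clusterCard t ⟨k, by omega⟩ : ℝ))
    else if t ⟨k + 1, by omega⟩ ≤ l ∧ (l : ℕ) < t ⟨k + 2, by omega⟩ then
      1 / (clusterCard t ⟨k + 1, by omega⟩ : ℝ)
    else 0

/-- The vector `m₂(t) = -(t₂ - t₀, …, t_K - t_{K-2})`. -/
def m₂ {K : ℕ} (t : Fin (K + 1) → ℕ) : Fin (K - 1) → ℝ :=
  fun k => -((t ⟨k + 2, by omega⟩ : ℝ) - (t ⟨k, by omega⟩ : ℝ))

/-- The matrix `M₃(t)`: the row for the `k`-th cluster and `ℓ ∈ {1, …, n_k - 1}` (written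
`ℓ = r.2 + 1`) is the average over the first `ℓ` positions of the cluster minus the average over
all its positions. -/
def M₃ (n : ℕ) {K : ℕ} (t : Fin (K + 1) → ℕ) :
    Matrix (Σ k : Fin K, Fin (clusterCard t k - 1)) (Fin n) ℝ :=
  Matrix.of fun r l =>
    (if t r.1.castSucc ≤ l ∧ (l : ℕ) < t r.1.castSucc + (r.2 + 1) then
      1 / ((r.2 : ℝ) + 1) else 0)
    - (if t r.1.castSucc ≤ l ∧ (l : ℕ) < t r.1.succ then
      1 / (clusterCard t r.1 : ℝ) else 0)

/-- The vector `m₃(t)`, with entries `n_k - ℓ`, `ℓ = 1, …, n_k - 1`. -/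
def m₃ {K : ℕ} (t : Fin (K + 1) → ℕ) : (Σ k : Fin K, Fin (clusterCard t k - 1)) → ℝ :=
  fun r => (clusterCard t r.1 : ℝ) - ((r.2 : ℝ) + 1)

/-- The index set of the `(n - 1) + (K - 1) + (n - K) = 2 (n - 1)` rows of `M(t)`. -/
abbrev Row (n : ℕ) {K : ℕ} (t : Fin (K + 1) → ℕ) : Type :=
  Fin (n - 1) ⊕ (Fin (K - 1) ⊕ (Σ k : Fin K, Fin (clusterCard t k - 1)))

/-- The matrix `M(t)`, made of `M₁`, `M₂(t)` and `M₃(t)` stacked. -/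
def M (n : ℕ) {K : ℕ} (t : Fin (K + 1) → ℕ) : Matrix (Row n t) (Fin n) ℝ :=
  Matrix.fromRows (M₁ n) (Matrix.fromRows (M₂ n t) (M₃ n t))

/-- The vector `m(t)`, made of `0`, `m₂(t)` and `m₃(t)` stacked. -/
def m (n : ℕ) {K : ℕ} (t : Fin (K + 1) → ℕ) : Row n t → ℝ :=
  Sum.elim (fun _ => 0) (Sum.elim (m₂ t) (m₃ t))

/-! ### The stacked polyhedron of `p` variables

The entries of `vec Y` are indexed by pairs (column, row), as in `Matrix.vec`. -/

/-- The block matrix with diagonal blocks `M(t⁽ʲ⁾)` and zero blocks off the diagonal. -/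
def stackedM {p : ℕ} (n : ℕ) {K : Fin p → ℕ} (t : ∀ j, Fin (K j + 1) → ℕ) :
    Matrix (Σ j, Row n (t j)) (Fin p × Fin n) ℝ :=
  Matrix.of fun r c => if r.1 = c.1 then M n (t r.1) r.2 c.2 else 0

/-- The vectors `m(t⁽ʲ⁾)` stacked. -/
def stackedm {p : ℕ} (n : ℕ) {K : Fin p → ℕ} (t : ∀ j, Fin (K j + 1) → ℕ) :
    (Σ j, Row n (t j)) → ℝ :=
  fun r => m n (t r.1) r.2

/-- The block diagonal matrix whose blocks are the permutation matrices of the `σ⁽ʲ⁾`, where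
the permutation matrix of `σ` maps `x` to `(x (σ 1), …, x (σ n))`. -/
def stackedPerm {p n : ℕ} (σ : Fin p → Equiv.Perm (Fin n)) :
    Matrix (Fin p × Fin n) (Fin p × Fin n) ℝ :=
  Matrix.of fun a b => if a.1 = b.1 then (σ a.1).permMatrix ℝ a.2 b.2 else 0

/-! ### The truncated Gaussian p-value of a polyhedron `{A x ≤ b}` -/

section PValue

variable {ι R : Type*} [Fintype ι] [DecidableEq ι]

/-- `c = S η (ηᵀ S η)⁻¹`. -/
def direction (S : Matrix ι ι ℝ) (η : ι → ℝ) : ι → ℝ :=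
  (η ⬝ᵥ S *ᵥ η)⁻¹ • (S *ᵥ η)

/-- `Z(x) = (I - c ηᵀ) x`. -/
def residual (S : Matrix ι ι ℝ) (η x : ι → ℝ) : ι → ℝ :=
  (1 - Matrix.vecMulVec (direction S η) η) *ᵥ x

/-- `𝒱⁻(z)`, the maximum of `(b_l - (A z)_l) / (A c)_l` over the `l` with `(A c)_l < 0`; it is
`-∞` if there is no such `l`. -/
def lowerLimit (A : Matrix R ι ℝ) (b : R → ℝ) (S : Matrix ι ι ℝ) (η z : ι → ℝ) : EReal :=
  ⨆ (l : R) (_ : (A *ᵥ direction S η) l < 0),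
    (((b l - (A *ᵥ z) l) / (A *ᵥ direction S η) l : ℝ) : EReal)

/-- `𝒱⁺(z)`, the minimum of `(b_l - (A z)_l) / (A c)_l` over the `l` with `(A c)_l > 0`; it is
`+∞` if there is no such `l`. -/
def upperLimit (A : Matrix R ι ℝ) (b : R → ℝ) (S : Matrix ι ι ℝ) (η z : ι → ℝ) : EReal :=
  ⨅ (l : R) (_ : 0 < (A *ᵥ direction S η) l),
    (((b l - (A *ᵥ z) l) / (A *ᵥ direction S η) l : ℝ) : EReal)

/-- The value at `s` of the cumulative distribution function of the Gaussian distribution with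
mean `ν` and variance `v`, truncated to `[a, b]` (that is, conditioned on `[a, b]`). -/
def truncatedGaussianCDF (ν : ℝ) (v : NNReal) (a b : EReal) (s : ℝ) : ℝ :=
  ((gaussianReal ν v)[|{u : ℝ | a ≤ u ∧ u ≤ b}]).real (Set.Iic s)

/-- The invariant statistic `T(x)`, the truncated Gaussian cdf with mean `0`, variance `ηᵀ S η`
and truncation limits `𝒱⁻(Z(x))`, `𝒱⁺(Z(x))`, evaluated at `ηᵀ x`. -/
def invariantStat (A : Matrix R ι ℝ) (b : R → ℝ) (S : Matrix ι ι ℝ) (η x : ι → ℝ) : ℝ :=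
  truncatedGaussianCDF 0 (Real.toNNReal (η ⬝ᵥ S *ᵥ η))
    (lowerLimit A b S η (residual S η x)) (upperLimit A b S η (residual S η x)) (η ⬝ᵥ x)

/-- The two-sided p-value `2 min (T(x), 1 - T(x))`. -/
def polyhedralPValue (A : Matrix R ι ℝ) (b : R → ℝ) (S : Matrix ι ι ℝ) (η x : ι → ℝ) : ℝ :=
  2 * min (invariantStat A b S η x) (1 - invariantStat A b S η x)

end PValue

/-- The p-value of the `n × p` data matrix `y`, for the test vector `κ`, the covariance matrix `Γ`
of the vectorized data, the sequences of right-limits `t⁽ʲ⁾` and the orderings `σ⁽ʲ⁾`. -/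
def pval {n p : ℕ} (lam : ℝ) (Γ : Matrix (Fin p × Fin n) (Fin p × Fin n) ℝ)
    {K : Fin p → ℕ} (t : ∀ j, Fin (K j + 1) → ℕ) (σ : Fin p → Equiv.Perm (Fin n))
    (κ : Fin p × Fin n → ℝ) (y : Matrix (Fin n) (Fin p) ℝ) : ℝ :=
  polyhedralPValue (stackedM n t * stackedPerm σ) (lam • stackedm n t) Γ κ y.vec

/-- The set of the data matrices `y` for which, for every variable `j`, the clustering given by
the solution of the one-dimensional problem for the column `j` is `𝒞(t⁽ʲ⁾, σ⁽ʲ⁾)`, and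
`y (σ⁽ʲ⁾ 1) j ≥ ⋯ ≥ y (σ⁽ʲ⁾ n) j`. -/
def conditioningSet {n p : ℕ} (lam : ℝ) {K : Fin p → ℕ} (t : ∀ j, Fin (K j + 1) → ℕ)
    (σ : Fin p → Equiv.Perm (Fin n)) : Set (Matrix (Fin n) (Fin p) ℝ) :=
  {y | ∀ j, clusteringOf (solution lam fun i => y i j) = clusteringOfOrder (t j) (σ j) ∧
    Antitone fun l => y (σ j l) j}

end ConvexClustering

end

namespace ConvexClustering

/-! ### The probability integral transform -/

/-! The proof joins a Gaussian fact about polyhedra with a description of the clustering event as a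
polyhedron.

Polyhedral lemma. For `x` Gaussian with covariance `S`, write `x = z + u c` with `u = η ⬝ᵥ x` and
`z` the residual. The direction `c` is chosen so that `z` and `u` are uncorrelated, hence
independent, and `η ⬝ᵥ μ = 0` makes `u` centred. For fixed `z`, each row of `A x ≤ b` bounds `u`
from one side or constrains `z` alone, so on the polyhedron `u` is a Gaussian truncated to `[𝒱⁻(z),
𝒱⁺(z)]`. The statistic is the cdf of that very law evaluated at `u`, hence uniform, and `s ↦ 2 min
(s, 1 - s)` preserves the uniform law. Integrating over `z` (`measure_polyhedron_inter_pvalue`)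
shows that the p-value is uniform and independent of membership in the polyhedron.

Clustering event. The criterion is convex, so minimality means that all one-sided directional
derivatives are nonnegative (`isSolution_iff_dirAbs`). Once the ordered clusters are known, pairs in
different clusters contribute linearly, and the condition splits over clusters into inequalities on
subset sums (`isSolution_iff_label`). The total over a cluster fixes its value, namely its mean
minus `lam * (n - t_k - t_{k-1})`; strict decrease of these values is `M₂` with strict inequalities.
For sorted data the worst subset of given size is an initial segment, which gives `M₃`. The event
thus differs from the closed polyhedron only on finitely many hyperplanes, null because `Γ` is
invertible (`ae_mem_conditioningSet_iff`). -/

theorem continuous_measureReal_Iic (ρ : Measure ℝ) [IsProbabilityMeasure ρ]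
    [NullSingletonClass ρ] : Continuous fun s => ρ.real (Set.Iic s) := by
  have h : Continuous (cdf ρ) := by
    rw [continuous_iff_continuousAt]
    intro x
    rw [(cdf ρ).mono.continuousAt_iff_leftLim_eq_rightLim, (cdf ρ).rightLim_eq]
    have h1 : (cdf ρ).measure {x} = 0 := by rw [measure_cdf]; exact measure_singleton x
    rw [StieltjesFunction.measure_singleton, ENNReal.ofReal_eq_zero] at h1
    exact le_antisymm ((cdf ρ).mono.leftLim_le le_rfl) (by linarith)
  have e : ⇑(cdf ρ) = fun s => ρ.real (Set.Iic s) := funext (cdf_eq_real ρ)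
  rwa [e] at h

/-- The cdf may be flat, so no inverse is used: by monotonicity and continuity the sublevel set is a
closed half-line, and by the intermediate value theorem the cdf equals `y` at its endpoint. -/
theorem measure_measureReal_Iic_le (ρ : Measure ℝ) [IsProbabilityMeasure ρ]
    [NullSingletonClass ρ] {y : ℝ} (hy0 : 0 < y) (hy1 : y < 1) :
    ρ {s | ρ.real (Set.Iic s) ≤ y} = ENNReal.ofReal y := by
  have hcont := continuous_measureReal_Iic ρ
  have hmono : Monotone fun s => ρ.real (Set.Iic s) := fun a b hab =>
    measureReal_mono (Set.Iic_subset_Iic.2 hab)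
  have hbot := tendsto_cdf_atBot ρ
  have htop := tendsto_cdf_atTop ρ
  obtain ⟨a, ha⟩ := (hbot.eventually_lt_const hy0).exists
  obtain ⟨b, hb⟩ := (htop.eventually_const_lt hy1).exists
  rw [cdf_eq_real] at ha hb
  set A : Set ℝ := {s | ρ.real (Set.Iic s) ≤ y} with hA
  have hab : a ≤ b := by
    by_contra hlt
    have := hmono (not_le.1 hlt).le
    simp only at this
    linarith
  obtain ⟨s, -, hs⟩ := intermediate_value_Icc hab hcont.continuousOn ⟨ha.le, hb.le⟩
  have hsA : s ∈ A := le_of_eq hs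
  have hbdd : BddAbove A := ⟨b, fun u hu => by
    by_contra hlt
    have := hmono (not_le.1 hlt).le
    simp only [hA, Set.mem_ofPred_eq] at this hu
    linarith⟩
  have hclosed : IsClosed A := isClosed_le hcont continuous_const
  have hmem : sSup A ∈ A := hclosed.csSup_mem ⟨s, hsA⟩ hbdd
  have hAeq : A = Set.Iic (sSup A) := by
    ext u
    exact ⟨fun hu => le_csSup hbdd hu, fun hu => (hmono hu).trans hmem⟩
  have hval : ρ.real (Set.Iic (sSup A)) = y :=
    le_antisymm hmem (hs.symm.le.trans (hmono (le_csSup hbdd hsA)))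
  rw [hAeq, ← hval, ofReal_measureReal]

theorem map_measureReal_Iic (ρ : Measure ℝ) [IsProbabilityMeasure ρ] [NullSingletonClass ρ] :
    ρ.map (fun s => ρ.real (Set.Iic s)) = volume.restrict (Set.Icc 0 1) := by
  have hmeas : Measurable fun s => ρ.real (Set.Iic s) := (continuous_measureReal_Iic ρ).measurable
  have := Measure.isProbabilityMeasure_map (μ := ρ) hmeas.aemeasurable
  refine Measure.ext_of_Iic _ _ fun y => ?_
  rw [Measure.map_apply hmeas measurableSet_Iic, Measure.restrict_apply measurableSet_Iic]
  have hpre : (fun s => ρ.real (Set.Iic s)) ⁻¹' Set.Iic y = {s | ρ.real (Set.Iic s) ≤ y} := rfl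
  rw [hpre]
  rcases lt_or_ge y 0 with hy | hy
  · have h1 : {s | ρ.real (Set.Iic s) ≤ y} = ∅ := by
      ext s
      have : 0 ≤ ρ.real (Set.Iic s) := measureReal_nonneg
      simp only [Set.mem_ofPred_eq, Set.mem_empty_iff_false, iff_false, not_le]
      linarith
    have h2 : Set.Iic y ∩ Set.Icc 0 1 = ∅ := by
      ext s
      simp only [Set.mem_inter_iff, Set.mem_Iic, Set.mem_Icc, Set.mem_empty_iff_false, iff_false]
      rintro ⟨h, h', -⟩
      linarith
    rw [h1, h2, measure_empty, measure_empty]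
  rcases le_or_gt 1 y with hy1 | hy1
  · have h1 : {s | ρ.real (Set.Iic s) ≤ y} = Set.univ :=
      Set.eq_univ_of_forall fun s => measureReal_le_one.trans hy1
    have h2 : Set.Iic y ∩ Set.Icc 0 1 = Set.Icc 0 1 :=
      Set.inter_eq_right.2 fun s hs => hs.2.trans hy1
    rw [h1, h2, measure_univ, Real.volume_Icc]
    norm_num
  have h2 : Set.Iic y ∩ Set.Icc 0 1 = Set.Icc 0 y := by
    ext s
    simp only [Set.mem_inter_iff, Set.mem_Iic, Set.mem_Icc]
    constructor
    · rintro ⟨h, h', -⟩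
      exact ⟨h', h⟩
    · rintro ⟨h, h'⟩
      exact ⟨h', h, by linarith⟩
  rw [h2, Real.volume_Icc, sub_zero]
  rcases hy.eq_or_lt with rfl | hy0
  -- At `y = 0` the sublevel set may be empty or unbounded below with no attained level, so its
  -- measure is squeezed by those of small positive levels.
  · rw [ENNReal.ofReal_zero]
    refine le_antisymm (ENNReal.le_of_forall_pos_le_add fun ε hε _ => ?_) bot_le
    have hδ : (0 : ℝ) < min ε (1 / 2) := lt_min hε (by norm_num)
    have h := measure_measureReal_Iic_le ρ hδ
      ((min_le_right _ _).trans_lt (by norm_num))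
    calc ρ {s | ρ.real (Set.Iic s) ≤ 0}
        ≤ ρ {s | ρ.real (Set.Iic s) ≤ min (ε : ℝ) (1 / 2)} :=
          measure_mono fun s hs => le_trans hs hδ.le
      _ = ENNReal.ofReal (min (ε : ℝ) (1 / 2)) := h
      _ ≤ ENNReal.ofReal ε := ENNReal.ofReal_le_ofReal (min_le_left _ _)
      _ = 0 + ε := by rw [ENNReal.ofReal_coe_nnreal, zero_add]
  · exact measure_measureReal_Iic_le ρ hy0 hy1

/-- The tent map is two-to-one with slopes `±2`: a sublevel set consists of two end intervals, each
of length `y / 2`. -/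
theorem map_two_mul_min_one_sub :
    (volume.restrict (Set.Icc (0 : ℝ) 1)).map (fun s => 2 * min s (1 - s))
      = volume.restrict (Set.Icc 0 1) := by
  have hmeas : Measurable fun s : ℝ => 2 * min s (1 - s) := by fun_prop
  refine Measure.ext_of_Iic _ _ fun y => ?_
  rw [Measure.map_apply hmeas measurableSet_Iic, Measure.restrict_apply (hmeas measurableSet_Iic),
    Measure.restrict_apply measurableSet_Iic]
  rcases lt_or_ge y 1 with hy | hy
  · have h1 : (fun s : ℝ => 2 * min s (1 - s)) ⁻¹' Set.Iic y ∩ Set.Icc 0 1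
        = Set.Icc 0 (y / 2) ∪ Set.Icc (1 - y / 2) 1 := by
      ext s
      simp only [Set.mem_inter_iff, Set.mem_preimage, Set.mem_Iic, Set.mem_Icc, Set.mem_union]
      rcases min_cases s (1 - s) with ⟨h, h'⟩ | ⟨h, h'⟩ <;> rw [h]
      · constructor
        · rintro ⟨h1, h2, h3⟩
          exact Or.inl ⟨h2, by linarith⟩
        · rintro (⟨h1, h2⟩ | ⟨h1, h2⟩)
          · exact ⟨by linarith, h1, by linarith⟩
          · exact ⟨by linarith, by linarith, h2⟩
      · constructor
        · rintro ⟨h1, h2, h3⟩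
          exact Or.inr ⟨by linarith, h3⟩
        · rintro (⟨h1, h2⟩ | ⟨h1, h2⟩)
          · exact ⟨by linarith, h1, by linarith⟩
          · exact ⟨by linarith, by linarith, h2⟩
    have h2 : Set.Iic y ∩ Set.Icc 0 1 = Set.Icc 0 y := by
      ext s
      simp only [Set.mem_inter_iff, Set.mem_Iic, Set.mem_Icc]
      constructor
      · rintro ⟨h, h', -⟩
        exact ⟨h', h⟩
      · rintro ⟨h, h'⟩
        exact ⟨h', h, by linarith⟩
    have hdisj : Disjoint (Set.Icc 0 (y / 2)) (Set.Icc (1 - y / 2) 1) := by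
      rw [Set.disjoint_left]
      rintro s ⟨-, h⟩ ⟨h', -⟩
      linarith
    rw [h1, h2, measure_union hdisj measurableSet_Icc, Real.volume_Icc, Real.volume_Icc,
      Real.volume_Icc]
    rcases le_total 0 y with h0 | h0
    · rw [← ENNReal.ofReal_add (by linarith) (by linarith)]
      congr 1
      ring
    -- For `y ≤ 0` all lengths are nonpositive, and `ENNReal.ofReal` truncates them to `0`.
    · rw [ENNReal.ofReal_of_nonpos (by linarith), ENNReal.ofReal_of_nonpos (by linarith),
        ENNReal.ofReal_of_nonpos (by linarith), add_zero]
  · congr 1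
    ext s
    simp only [Set.mem_inter_iff, Set.mem_preimage, Set.mem_Iic, Set.mem_Icc]
    refine and_congr_left fun hs => iff_of_true ?_ (hs.2.trans hy)
    have h1 := min_le_left s (1 - s)
    have h2 := min_le_right s (1 - s)
    linarith

theorem map_two_mul_min_measureReal_Iic (ρ : Measure ℝ) [IsProbabilityMeasure ρ]
    [NullSingletonClass ρ] :
    ρ.map (fun s => 2 * min (ρ.real (Set.Iic s)) (1 - ρ.real (Set.Iic s)))
      = volume.restrict (Set.Icc 0 1) := by
  have hmeas : Measurable fun s => ρ.real (Set.Iic s) := (continuous_measureReal_Iic ρ).measurable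
  rw [← map_two_mul_min_one_sub, ← map_measureReal_Iic ρ,
    Measure.map_map (by fun_prop) hmeas]
  rfl

/-! ### The polyhedral lemma -/

theorem measurableSet_truncation (a b : EReal) : MeasurableSet {u : ℝ | a ≤ u ∧ u ≤ b} :=
  (measurableSet_le measurable_const measurable_coe_real_ereal).inter
    (measurableSet_le measurable_coe_real_ereal measurable_const)

theorem truncatedGaussianCDF_eq (ν : ℝ) (v : NNReal) (a b : EReal) (s : ℝ) :
    truncatedGaussianCDF ν v a b s
      = ((gaussianReal ν v {u : ℝ | a ≤ u ∧ u ≤ b})⁻¹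
        * gaussianReal ν v {u : ℝ | (a ≤ u ∧ u ≤ b) ∧ u ≤ s}).toReal := by
  unfold truncatedGaussianCDF Measure.real
  rw [cond_apply (measurableSet_truncation a b)]
  rfl

/-- The numerator and denominator of the cdf are measures of sections of measurable sets in `α × ℝ`,
hence measurable in the limits and the argument jointly. -/
theorem measurable_truncatedGaussianCDF {α : Type*} [MeasurableSpace α] (ν : ℝ) (v : NNReal)
    {a b : α → EReal} {s : α → ℝ} (ha : Measurable a) (hb : Measurable b) (hs : Measurable s) :
    Measurable fun x => truncatedGaussianCDF ν v (a x) (b x) (s x) := by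
  simp only [truncatedGaussianCDF_eq]
  have hu : Measurable fun q : α × ℝ => (q.2 : EReal) :=
    measurable_coe_real_ereal.comp measurable_snd
  have h1 : MeasurableSet {q : α × ℝ | a q.1 ≤ q.2 ∧ (q.2 : EReal) ≤ b q.1} :=
    (measurableSet_le (ha.comp measurable_fst) hu).inter
      (measurableSet_le hu (hb.comp measurable_fst))
  have h2 : MeasurableSet {q : α × ℝ | (a q.1 ≤ q.2 ∧ (q.2 : EReal) ≤ b q.1) ∧ q.2 ≤ s q.1} :=
    h1.inter (measurableSet_le measurable_snd (hs.comp measurable_fst))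
  have h1' := measurable_measure_prodMk_left (ν := gaussianReal ν v) h1
  have h2' := measurable_measure_prodMk_left (ν := gaussianReal ν v) h2
  exact (h1'.inv.mul h2').ennreal_toReal

/-- The product form, rather than a conditional law, stays true when the truncation interval has
mass zero, and can be integrated over the residual. -/
theorem gaussianReal_truncation_inter_pvalue {ν : ℝ} {v : NNReal} (hv : v ≠ 0) (a b : EReal)
    {B : Set ℝ} (hB : MeasurableSet B) :
    gaussianReal ν v {u : ℝ | (a ≤ u ∧ u ≤ b) ∧
        2 * min (truncatedGaussianCDF ν v a b u) (1 - truncatedGaussianCDF ν v a b u) ∈ B}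
      = gaussianReal ν v {u : ℝ | a ≤ u ∧ u ≤ b} * volume.restrict (Set.Icc 0 1) B := by
  set I : Set ℝ := {u : ℝ | a ≤ u ∧ u ≤ b} with hI
  have hIm : MeasurableSet I := measurableSet_truncation a b
  rcases eq_or_ne (gaussianReal ν v I) 0 with h0 | h0
  · rw [h0, zero_mul]
    exact measure_mono_null (fun u hu => hu.1) h0
  have := nullSingletonClass_gaussianReal (μ := ν) hv
  have hprob := cond_isProbabilityMeasure h0
  have hatom : NullSingletonClass ((gaussianReal ν v)[|I]) :=
    ⟨fun x => cond_absolutelyContinuous (measure_singleton x)⟩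
  have hT : Measurable fun u : ℝ =>
      2 * min (truncatedGaussianCDF ν v a b u) (1 - truncatedGaussianCDF ν v a b u) := by
    have := measurable_truncatedGaussianCDF ν v (a := fun _ : ℝ => a) (b := fun _ => b)
      measurable_const measurable_const measurable_id
    simp only [id] at this
    fun_prop
  have key : (gaussianReal ν v)[|I] ((fun u : ℝ =>
      2 * min (truncatedGaussianCDF ν v a b u) (1 - truncatedGaussianCDF ν v a b u)) ⁻¹' B)
      = volume.restrict (Set.Icc 0 1) B := by
    rw [← map_two_mul_min_measureReal_Iic ((gaussianReal ν v)[|I]), ← Measure.map_apply hT hB]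
    rfl
  rw [← key, cond_apply hIm, ← mul_assoc, ENNReal.mul_inv_cancel h0 (measure_ne_top _ _), one_mul]
  rfl

section Polyhedron

variable {ι R : Type*} [Fintype ι]

theorem measurable_mulVec_apply (A : Matrix R ι ℝ) (l : R) :
    Measurable fun z : ι → ℝ => (A *ᵥ z) l := by
  simp only [Matrix.mulVec, dotProduct]
  fun_prop

theorem measurable_dotProduct (η : ι → ℝ) : Measurable fun x : ι → ℝ => η ⬝ᵥ x := by
  simp only [dotProduct]
  fun_prop

/-- Each row is solved for `u`; the sign of `(A c)_l` decides whether it is a lower bound, an upper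
bound, or a condition on `z` only. -/
theorem forall_le_iff_limits (A : Matrix R ι ℝ) (b : R → ℝ) (S : Matrix ι ι ℝ) (η z : ι → ℝ)
    (u : ℝ) :
    (∀ l, (A *ᵥ z) l + u * (A *ᵥ direction S η) l ≤ b l) ↔
      (∀ l, (A *ᵥ direction S η) l = 0 → (A *ᵥ z) l ≤ b l) ∧
        lowerLimit A b S η z ≤ u ∧ u ≤ upperLimit A b S η z := by
  simp only [lowerLimit, upperLimit, iSup_le_iff, le_iInf_iff, EReal.coe_le_coe_iff]
  constructor
  · intro h
    refine ⟨fun l hl => ?_, fun l hl => ?_, fun l hl => ?_⟩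
    · simpa [hl] using h l
    · rw [div_le_iff_of_neg hl]
      linarith [h l]
    · rw [le_div_iff₀ hl]
      linarith [h l]
  · rintro ⟨h0, hn, hp⟩ l
    rcases lt_trichotomy ((A *ᵥ direction S η) l) 0 with hl | hl | hl
    · have := hn l hl
      rw [div_le_iff_of_neg hl] at this
      linarith
    · simpa [hl] using h0 l hl
    · have := hp l hl
      rw [le_div_iff₀ hl] at this
      linarith

theorem measurable_lowerLimit [Countable R] (A : Matrix R ι ℝ) (b : R → ℝ) (S : Matrix ι ι ℝ)
    (η : ι → ℝ) : Measurable (lowerLimit A b S η) := by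
  unfold lowerLimit
  refine Measurable.iSup fun l => Measurable.iSup fun _ => measurable_coe_real_ereal.comp ?_
  exact (measurable_const.sub (measurable_mulVec_apply A l)).div_const _

theorem measurable_upperLimit [Countable R] (A : Matrix R ι ℝ) (b : R → ℝ) (S : Matrix ι ι ℝ)
    (η : ι → ℝ) : Measurable (upperLimit A b S η) := by
  unfold upperLimit
  refine Measurable.iInf fun l => Measurable.iInf fun _ => measurable_coe_real_ereal.comp ?_
  exact (measurable_const.sub (measurable_mulVec_apply A l)).div_const _

variable [DecidableEq ι]

theorem residual_eq (S : Matrix ι ι ℝ) (η x : ι → ℝ) :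
    residual S η x = x - (η ⬝ᵥ x) • direction S η := by
  unfold residual
  rw [Matrix.sub_mulVec, Matrix.one_mulVec, Matrix.vecMulVec_mulVec]
  ext i
  simp

theorem mulVec_eq_residual_add (A : Matrix R ι ℝ) (S : Matrix ι ι ℝ) (η x : ι → ℝ) (l : R) :
    (A *ᵥ x) l = (A *ᵥ residual S η x) l + (η ⬝ᵥ x) * (A *ᵥ direction S η) l := by
  rw [residual_eq, Matrix.mulVec_sub, Matrix.mulVec_smul]
  simp

theorem measurable_residual (S : Matrix ι ι ℝ) (η : ι → ℝ) : Measurable (residual S η) :=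
  measurable_pi_lambda _ fun i => measurable_mulVec_apply _ i

theorem measurable_polyhedralPValue [Countable R] (A : Matrix R ι ℝ) (b : R → ℝ)
    (S : Matrix ι ι ℝ) (η : ι → ℝ) : Measurable (polyhedralPValue A b S η) := by
  have : Measurable (invariantStat A b S η) :=
    measurable_truncatedGaussianCDF _ _
      ((measurable_lowerLimit A b S η).comp (measurable_residual S η))
      ((measurable_upperLimit A b S η).comp (measurable_residual S η)) (measurable_dotProduct η)
  unfold polyhedralPValue
  fun_prop

theorem covariance_dotProduct_multivariateGaussian {S : Matrix ι ι ℝ} (hS : S.PosSemidef)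
    (μ : EuclideanSpace ℝ ι) (a b : ι → ℝ) :
    cov[fun x : EuclideanSpace ℝ ι => a ⬝ᵥ x.ofLp, fun x => b ⬝ᵥ x.ofLp; multivariateGaussian μ S]
      = a ⬝ᵥ S *ᵥ b := by
  have h := covarianceBilin_multivariateGaussian (μ := μ) hS (WithLp.toLp 2 a) (WithLp.toLp 2 b)
  rw [covarianceBilin_apply_eq_cov IsGaussian.memLp_two_id] at h
  simpa [PiLp.inner_apply, dotProduct, mul_comm] using h

theorem map_dotProduct_multivariateGaussian {S : Matrix ι ι ℝ} (hS : S.PosSemidef)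
    (μ : EuclideanSpace ℝ ι) (a : ι → ℝ) :
    (multivariateGaussian μ S).map (fun x => a ⬝ᵥ x.ofLp)
      = gaussianReal (a ⬝ᵥ μ.ofLp) (a ⬝ᵥ S *ᵥ a).toNNReal := by
  set L : EuclideanSpace ℝ ι →L[ℝ] ℝ := innerSL ℝ (WithLp.toLp 2 a) with hL
  have hLa : ∀ x : EuclideanSpace ℝ ι, L x = a ⬝ᵥ x.ofLp := fun x => by
    simp [hL, PiLp.inner_apply, dotProduct, mul_comm]
  have hfun : (fun x : EuclideanSpace ℝ ι => a ⬝ᵥ x.ofLp) = ⇑L := funext fun x => (hLa x).symm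
  rw [hfun, IsGaussian.map_eq_gaussianReal,
    L.integral_comp_comm (φ := fun x => x) IsGaussian.integrable_id,
    integral_id_multivariateGaussian, hLa, ← covariance_self (by fun_prop), ← hfun,
    covariance_dotProduct_multivariateGaussian hS]

/-- Jointly Gaussian vectors are independent as soon as their coordinates are uncorrelated. -/
theorem indepFun_residual_dotProduct {S : Matrix ι ι ℝ} (hS : S.PosDef) (μ : EuclideanSpace ℝ ι)
    {η : ι → ℝ} (hη : η ≠ 0) :
    IndepFun (fun x : EuclideanSpace ℝ ι => residual S η x.ofLp) (fun x => η ⬝ᵥ x.ofLp)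
      (multivariateGaussian μ S) := by
  have hpos : 0 < η ⬝ᵥ S *ᵥ η := by simpa using hS.dotProduct_mulVec_pos hη
  -- The scalar is viewed as a family over `Unit` to fit the independence criterion for two families
  -- of coordinates.
  set L : EuclideanSpace ℝ ι →ₗ[ℝ] (ι → ℝ) × (Unit → ℝ) :=
    ((Matrix.mulVecLin (1 - Matrix.vecMulVec (direction S η) η)).prod
      (LinearMap.pi fun _ => dotProductBilin ℝ ℝ η)).comp
      (WithLp.linearEquiv 2 ℝ (ι → ℝ)).toLinearMap with hL
  have hG := (IsGaussian.hasGaussianLaw_id (μ := multivariateGaussian μ S)).map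
    (LinearMap.toContinuousLinearMap L)
  have hI : IndepFun (fun (x : EuclideanSpace ℝ ι) i => residual S η x.ofLp i)
      (fun x (_ : Unit) => η ⬝ᵥ x.ofLp) (multivariateGaussian μ S) := by
    refine HasGaussianLaw.indepFun_of_covariance_eval
      (X := fun i (x : EuclideanSpace ℝ ι) => residual S η x.ofLp i)
      (Y := fun (_ : Unit) x => η ⬝ᵥ x.ofLp) hG fun i _ => ?_
    have hrow : (fun x : EuclideanSpace ℝ ι => residual S η x.ofLp i)
        = fun x => ((1 - Matrix.vecMulVec (direction S η) η) i) ⬝ᵥ x.ofLp := rfl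
    rw [hrow, covariance_dotProduct_multivariateGaussian hS.posSemidef]
    -- The covariances are the coordinates of the residual of `S η`, which vanishes by the
    -- normalization of `c`.
    have : (1 - Matrix.vecMulVec (direction S η) η) i ⬝ᵥ S *ᵥ η = residual S η (S *ᵥ η) i := rfl
    rw [this, residual_eq]
    simp only [direction, Pi.sub_apply, Pi.smul_apply, smul_eq_mul]
    rw [mul_inv_cancel_left₀ hpos.ne', sub_self]
  exact hI.comp measurable_id (measurable_pi_apply ())

theorem measure_polyhedron_inter_pvalue [Countable R] {S : Matrix ι ι ℝ} (hS : S.PosDef)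
    (μ : ι → ℝ) {η : ι → ℝ} (hη : η ≠ 0) (hημ : η ⬝ᵥ μ = 0) (A : Matrix R ι ℝ) (b : R → ℝ)
    {B : Set ℝ} (hB : MeasurableSet B) :
    multivariateGaussian (WithLp.toLp 2 μ) S
        {x | (∀ l, (A *ᵥ x.ofLp) l ≤ b l) ∧ polyhedralPValue A b S η x.ofLp ∈ B}
      = multivariateGaussian (WithLp.toLp 2 μ) S {x | ∀ l, (A *ᵥ x.ofLp) l ≤ b l}
        * volume.restrict (Set.Icc 0 1) B := by
  have hpos : 0 < η ⬝ᵥ S *ᵥ η := by simpa using hS.dotProduct_mulVec_pos hη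
  set v := (η ⬝ᵥ S *ᵥ η).toNNReal with hv
  have hv0 : v ≠ 0 := by simpa [hv] using hpos
  set G := multivariateGaussian (WithLp.toLp 2 μ) S with hG
  have hZ : Measurable fun x : EuclideanSpace ℝ ι => residual S η x.ofLp :=
    (measurable_residual S η).comp (by fun_prop)
  have hU : Measurable fun x : EuclideanSpace ℝ ι => η ⬝ᵥ x.ofLp :=
    (measurable_dotProduct η).comp (by fun_prop)
  have hprod : G.map (fun x => (residual S η x.ofLp, η ⬝ᵥ x.ofLp))
      = (G.map fun x => residual S η x.ofLp).prod (gaussianReal 0 v) := by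
    rw [(indepFun_iff_map_prod_eq_prod_map_map hZ.aemeasurable hU.aemeasurable).1
      (indepFun_residual_dotProduct hS _ hη), map_dotProduct_multivariateGaussian hS.posSemidef,
      ← hv]
    simp [hημ, hG]
  have hl := measurable_lowerLimit A b S η
  have hr := measurable_upperLimit A b S η
  set F : Set ((ι → ℝ) × ℝ) :=
    {q | ∀ l, (A *ᵥ q.1) l + q.2 * (A *ᵥ direction S η) l ≤ b l} with hF
  set Q : (ι → ℝ) × ℝ → ℝ := fun q =>
    2 * min (truncatedGaussianCDF 0 v (lowerLimit A b S η q.1) (upperLimit A b S η q.1) q.2)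
      (1 - truncatedGaussianCDF 0 v (lowerLimit A b S η q.1) (upperLimit A b S η q.1) q.2) with hQ
  have hFm : MeasurableSet F := by
    have : F = ⋂ l, {q : (ι → ℝ) × ℝ | (A *ᵥ q.1) l + q.2 * (A *ᵥ direction S η) l ≤ b l} := by
      ext q; simp [hF]
    rw [this]
    exact MeasurableSet.iInter fun l => measurableSet_le
      (((measurable_mulVec_apply A l).comp measurable_fst).add (measurable_snd.mul_const _))
      measurable_const
  have hQm : Measurable Q := by
    have := measurable_truncatedGaussianCDF 0 v (hl.comp measurable_fst)
      (hr.comp measurable_fst) (measurable_snd (α := ι → ℝ) (β := ℝ))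
    simp only [Function.comp_def] at this
    fun_prop
  have hFQm : MeasurableSet (F ∩ Q ⁻¹' B) := hFm.inter (hQm hB)
  have e1 : {x : EuclideanSpace ℝ ι | (∀ l, (A *ᵥ x.ofLp) l ≤ b l) ∧
      polyhedralPValue A b S η x.ofLp ∈ B}
      = (fun x => (residual S η x.ofLp, η ⬝ᵥ x.ofLp)) ⁻¹' (F ∩ Q ⁻¹' B) := by
    ext x
    refine and_congr (forall_congr' fun l => ?_) Iff.rfl
    rw [mulVec_eq_residual_add A S η]
  have e2 : {x : EuclideanSpace ℝ ι | ∀ l, (A *ᵥ x.ofLp) l ≤ b l}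
      = (fun x => (residual S η x.ofLp, η ⬝ᵥ x.ofLp)) ⁻¹' F := by
    ext x
    refine forall_congr' fun l => ?_
    rw [mulVec_eq_residual_add A S η]
  rw [e1, e2, ← Measure.map_apply (hZ.prodMk hU) hFQm, ← Measure.map_apply (hZ.prodMk hU) hFm,
    hprod, Measure.prod_apply hFQm, Measure.prod_apply hFm,
    ← lintegral_mul_const _ (measurable_measure_prodMk_left hFm)]
  refine lintegral_congr fun z => ?_
  -- If a row not involving `u` fails at `z`, the section of the polyhedron is empty and both sides
  -- vanish.
  by_cases h0 : ∀ l, (A *ᵥ direction S η) l = 0 → (A *ᵥ z) l ≤ b l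
  · have h1 : Prod.mk z ⁻¹' F
        = {u : ℝ | lowerLimit A b S η z ≤ u ∧ u ≤ upperLimit A b S η z} := by
      ext u
      exact (forall_le_iff_limits A b S η z u).trans (and_iff_right h0)
    have h2 : Prod.mk z ⁻¹' (F ∩ Q ⁻¹' B)
        = {u : ℝ | (lowerLimit A b S η z ≤ u ∧ u ≤ upperLimit A b S η z) ∧ Q (z, u) ∈ B} := by
      rw [Set.preimage_inter, h1]
      rfl
    rw [h1, h2]
    exact gaussianReal_truncation_inter_pvalue hv0 _ _ hB
  · have h1 : Prod.mk z ⁻¹' F = ∅ := by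
      ext u
      exact iff_of_false (fun hu => h0 ((forall_le_iff_limits A b S η z u).1 hu).1) id
    rw [Set.preimage_inter, h1, Set.empty_inter, measure_empty, zero_mul]

theorem measure_hyperplane_multivariateGaussian {S : Matrix ι ι ℝ} (hS : S.PosDef)
    (μ : EuclideanSpace ℝ ι) {a : ι → ℝ} (ha : a ≠ 0) (r : ℝ) :
    multivariateGaussian μ S {x | a ⬝ᵥ x.ofLp = r} = 0 := by
  have hpos : 0 < a ⬝ᵥ S *ᵥ a := by simpa using hS.dotProduct_mulVec_pos ha
  have hU : Measurable fun x : EuclideanSpace ℝ ι => a ⬝ᵥ x.ofLp :=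
    (measurable_dotProduct a).comp (by fun_prop)
  have h : {x : EuclideanSpace ℝ ι | a ⬝ᵥ x.ofLp = r} = (fun x => a ⬝ᵥ x.ofLp) ⁻¹' {r} := rfl
  have := nullSingletonClass_gaussianReal (μ := a ⬝ᵥ μ.ofLp)
    (v := (a ⬝ᵥ S *ᵥ a).toNNReal) (by simpa using hpos)
  rw [h, ← Measure.map_apply hU (measurableSet_singleton r),
    map_dotProduct_multivariateGaussian hS.posSemidef, measure_singleton]

end Polyhedron

/-! ### Optimality conditions -/

theorem sum_sum_Ioi_of_symm {n : ℕ} (f : Fin n → Fin n → ℝ) (hsymm : ∀ i j, f i j = f j i)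
    (hdiag : ∀ i, f i i = 0) :
    ∑ i, ∑ j ∈ Finset.Ioi i, f i j = (1 / 2) * ∑ i, ∑ j, f i j := by
  have h1 : ∑ i, ∑ j ∈ Finset.Ioi i, f i j = ∑ i, ∑ j, if i < j then f i j else 0 := by
    refine Finset.sum_congr rfl fun i _ => ?_
    rw [← Finset.sum_filter]
    congr 1
    ext j
    simp
  have h2 : ∑ i, ∑ j, (if j < i then f i j else 0) = ∑ i, ∑ j, if i < j then f i j else 0 := by
    rw [Finset.sum_comm]
    exact Finset.sum_congr rfl fun i _ => Finset.sum_congr rfl fun j _ => by rw [hsymm]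
  have h3 : ∑ i, ∑ j, f i j
      = (∑ i, ∑ j, if i < j then f i j else 0) + ∑ i, ∑ j, if j < i then f i j else 0 := by
    rw [← Finset.sum_add_distrib]
    refine Finset.sum_congr rfl fun i _ => ?_
    rw [← Finset.sum_add_distrib]
    refine Finset.sum_congr rfl fun j _ => ?_
    rcases lt_trichotomy i j with h | h | h
    · simp [h, h.not_gt]
    · simp [h, hdiag]
    · simp [h, h.not_gt]
  rw [h1, h3, h2]
  ring

/-- Summing over all ordered pairs makes invariance under permutations evident. -/
theorem objective_eq {n : ℕ} (lam : ℝ) (x B : Fin n → ℝ) :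
    objective lam x B
      = (1 / 2) * ∑ i, (B i - x i) ^ 2 + lam / 2 * ∑ i, ∑ j, |B j - B i| := by
  unfold objective
  rw [sum_sum_Ioi_of_symm (fun i j => |B j - B i|) (fun i j => abs_sub_comm _ _) (by simp)]
  ring

theorem objective_comp_perm {n : ℕ} (lam : ℝ) (x B : Fin n → ℝ) (σ : Equiv.Perm (Fin n)) :
    objective lam (x ∘ σ) (B ∘ σ) = objective lam x B := by
  rw [objective_eq, objective_eq]
  congr 2
  · exact Equiv.sum_comp σ fun i => (B i - x i) ^ 2
  · rw [← Equiv.sum_comp σ fun i => ∑ j, |B j - B i|]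
    exact Finset.sum_congr rfl fun i _ => Equiv.sum_comp σ fun j => |B j - B (σ i)|

theorem IsSolution.comp_perm {n : ℕ} {lam : ℝ} {x B : Fin n → ℝ} (h : IsSolution lam x B)
    (σ : Equiv.Perm (Fin n)) : IsSolution lam (x ∘ σ) (B ∘ σ) := by
  intro B'
  have h1 : B' = (B' ∘ σ.symm) ∘ σ := by ext; simp
  rw [h1, objective_comp_perm, objective_comp_perm]
  exact h _

theorem solution_comp_perm {n : ℕ} {lam : ℝ} (hlam : 0 < lam) (x : Fin n → ℝ)
    (σ : Equiv.Perm (Fin n)) : solution lam (x ∘ σ) = solution lam x ∘ σ :=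
  (solution_spec hlam _).unique hlam ((solution_spec hlam x).comp_perm σ)

theorem objective_swap_sub {n : ℕ} (lam : ℝ) (x B : Fin n → ℝ) {i j : Fin n} (hij : i ≠ j) :
    objective lam x (B ∘ Equiv.swap i j) - objective lam x B = (B i - B j) * (x i - x j) := by
  have h1 : ∑ k, ∑ l, |(B ∘ Equiv.swap i j) l - (B ∘ Equiv.swap i j) k|
      = ∑ k, ∑ l, |B l - B k| := by
    rw [← Equiv.sum_comp (Equiv.swap i j) fun k => ∑ l, |B l - B k|]
    exact Finset.sum_congr rfl fun k _ =>
      Equiv.sum_comp (Equiv.swap i j) fun l => |B l - B (Equiv.swap i j k)|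
  have h2 : ∑ k, ((B ∘ Equiv.swap i j) k - x k) ^ 2 - ∑ k, (B k - x k) ^ 2
      = 2 * ((B i - B j) * (x i - x j)) := by
    rw [← Finset.sum_sub_distrib, Fintype.sum_eq_add i j hij]
    · simp only [Function.comp_apply, Equiv.swap_apply_left, Equiv.swap_apply_right]
      ring
    · rintro k ⟨hi, hj⟩
      simp [Equiv.swap_apply_of_ne_of_ne hi hj]
  rw [objective_eq, objective_eq, h1]
  linarith

/-- Otherwise swapping the two values would not increase the criterion, giving a second minimizer.
Uniqueness also excludes ties in the data. -/
theorem IsSolution.lt_of_lt {n : ℕ} {lam : ℝ} (hlam : 0 < lam) {x B : Fin n → ℝ}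
    (h : IsSolution lam x B) {i j : Fin n} (hB : B i < B j) : x i < x j := by
  have hij : i ≠ j := by
    rintro rfl
    exact lt_irrefl _ hB
  have hs := objective_swap_sub lam x B hij
  by_contra hx
  rw [not_lt] at hx
  have hle : objective lam x (B ∘ Equiv.swap i j) ≤ objective lam x B := by
    nlinarith [mul_nonneg (sub_nonneg.2 hB.le) (sub_nonneg.2 hx)]
  have hsol : IsSolution lam x (B ∘ Equiv.swap i j) := fun B' => hle.trans (h B')
  have := congrFun (hsol.unique hlam h) i
  simp only [Function.comp_apply, Equiv.swap_apply_left] at this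
  exact hB.ne' this

/-- The one-sided directional derivative of the absolute value at `a` in the direction `e`. -/
noncomputable def dirAbs (a e : ℝ) : ℝ :=
  if 0 < a then e else if a < 0 then -e else |e|

theorem abs_add_dirAbs_le (a e : ℝ) : |a| + dirAbs a e ≤ |a + e| := by
  unfold dirAbs
  split_ifs with h1 h2
  · rw [abs_of_pos h1]
    exact le_abs_self _
  · rw [abs_of_neg h2]
    linarith [neg_abs_le (a + e)]
  · have : a = 0 := le_antisymm (not_lt.1 h1) (not_lt.1 h2)
    simp [this]

theorem eventually_abs_add_mul (a e : ℝ) :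
    ∀ᶠ ε : ℝ in nhdsWithin 0 (Set.Ioi 0), |a + ε * e| = |a| + ε * dirAbs a e := by
  have hc : Filter.Tendsto (fun ε : ℝ => a + ε * e) (nhdsWithin 0 (Set.Ioi 0)) (nhds a) := by
    have : ContinuousAt (fun ε : ℝ => a + ε * e) 0 := by fun_prop
    have h := this.tendsto
    simp only [zero_mul, add_zero] at h
    exact h.mono_left nhdsWithin_le_nhds
  unfold dirAbs
  split_ifs with h1 h2
  · filter_upwards [hc.eventually_const_lt h1] with ε hε
    rw [abs_of_pos h1, abs_of_pos hε]
  · filter_upwards [hc.eventually_lt_const h2] with ε hε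
    rw [abs_of_neg h2, abs_of_neg hε]
    ring
  · have : a = 0 := le_antisymm (not_lt.1 h1) (not_lt.1 h2)
    filter_upwards [self_mem_nhdsWithin] with ε hε
    rw [this, zero_add, abs_zero, zero_add, abs_mul, abs_of_pos hε]

/-- Absolute values are affine for small positive steps, which gives necessity; they lie above their
one-sided tangents, which gives sufficiency. -/
theorem isSolution_iff_dirAbs {n : ℕ} {lam : ℝ} (hlam : 0 < lam) (x B : Fin n → ℝ) :
    IsSolution lam x B ↔ ∀ d : Fin n → ℝ,
      0 ≤ ∑ i, (B i - x i) * d i + lam / 2 * ∑ i, ∑ j, dirAbs (B j - B i) (d j - d i) := by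
  have hq : ∀ d : Fin n → ℝ, ∑ i, (B i + d i - x i) ^ 2
      = ∑ i, (B i - x i) ^ 2 + 2 * ∑ i, (B i - x i) * d i + ∑ i, d i ^ 2 := fun d => by
    rw [Finset.mul_sum, ← Finset.sum_add_distrib, ← Finset.sum_add_distrib]
    exact Finset.sum_congr rfl fun i _ => by ring
  constructor
  · intro h d
    have hev : ∀ᶠ ε : ℝ in nhdsWithin 0 (Set.Ioi 0), ∀ i j,
        |B j - B i + ε * (d j - d i)| = |B j - B i| + ε * dirAbs (B j - B i) (d j - d i) :=
      Filter.eventually_all.2 fun i => Filter.eventually_all.2 fun j =>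
        eventually_abs_add_mul _ _
    set L := ∑ i, (B i - x i) * d i + lam / 2 * ∑ i, ∑ j, dirAbs (B j - B i) (d j - d i) with hL
    have hlim : Filter.Tendsto (fun ε : ℝ => L + ε * ((1 / 2) * ∑ i, d i ^ 2))
        (nhdsWithin 0 (Set.Ioi 0)) (nhds L) := by
      have : ContinuousAt (fun ε : ℝ => L + ε * ((1 / 2) * ∑ i, d i ^ 2)) 0 := by fun_prop
      have h' := this.tendsto
      simp only [zero_mul, add_zero] at h'
      exact h'.mono_left nhdsWithin_le_nhds
    -- Optimality against the step `ε d`, divided by `ε`, reads `0 ≤ L + ε (½ ‖d‖²)`; then `ε` tends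
    -- to `0`.
    refine ge_of_tendsto hlim ?_
    filter_upwards [hev, self_mem_nhdsWithin] with ε hε hpos
    have hobj := h fun i => B i + ε * d i
    have htv : ∑ i, ∑ j, |(B j + ε * d j) - (B i + ε * d i)|
        = ∑ i, ∑ j, |B j - B i| + ε * ∑ i, ∑ j, dirAbs (B j - B i) (d j - d i) := by
      rw [Finset.mul_sum, ← Finset.sum_add_distrib]
      refine Finset.sum_congr rfl fun i _ => ?_
      rw [Finset.mul_sum, ← Finset.sum_add_distrib]
      refine Finset.sum_congr rfl fun j _ => ?_
      rw [← hε i j]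
      congr 1
      ring
    rw [objective_eq, objective_eq, htv, hq fun i => ε * d i] at hobj
    have e1 : ∑ i, (B i - x i) * (ε * d i) = ε * ∑ i, (B i - x i) * d i := by
      rw [Finset.mul_sum]
      exact Finset.sum_congr rfl fun i _ => by ring
    have e2 : ∑ i, (ε * d i) ^ 2 = ε * (ε * ∑ i, d i ^ 2) := by
      rw [Finset.mul_sum, Finset.mul_sum]
      exact Finset.sum_congr rfl fun i _ => by ring
    rw [e1, e2] at hobj
    refine nonneg_of_mul_nonneg_right (a := ε) ?_ hpos
    rw [hL]
    linarith
  · intro h B'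
    have hd := h fun i => B' i - B i
    have hsq := hq fun i => B' i - B i
    have htv : ∑ i, ∑ j, |B j - B i| + ∑ i, ∑ j, dirAbs (B j - B i) ((B' j - B j) - (B' i - B i))
        ≤ ∑ i, ∑ j, |B' j - B' i| := by
      rw [← Finset.sum_add_distrib]
      refine Finset.sum_le_sum fun i _ => ?_
      rw [← Finset.sum_add_distrib]
      refine Finset.sum_le_sum fun j _ => ?_
      refine (abs_add_dirAbs_le _ _).trans (le_of_eq ?_)
      congr 1
      ring
    have hnn : 0 ≤ ∑ i, (B' i - B i) ^ 2 := Finset.sum_nonneg fun i _ => sq_nonneg _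
    simp only [add_sub_cancel] at hsq
    rw [objective_eq, objective_eq, hsq]
    have := mul_le_mul_of_nonneg_left htv (half_pos hlam).le
    linarith

/-! ### Subgradients of the sum of the pairwise distances -/

/-- Counts the ordered pairs separated by `A`: the cut function of the complete graph. -/
theorem sum_sum_abs_indicator {α : Type*} [DecidableEq α] {s A : Finset α} (hA : A ⊆ s) :
    ∑ i ∈ s, ∑ j ∈ s, |(if j ∈ A then (1 : ℝ) else 0) - (if i ∈ A then 1 else 0)|
      = 2 * (A.card * ((s.card : ℝ) - A.card)) := by
  have hsum : ∑ i ∈ s, (if i ∈ A then (1 : ℝ) else 0) = A.card := by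
    rw [← Finset.sum_filter, Finset.filter_mem_eq_inter, Finset.inter_eq_right.2 hA]
    simp
  set f : α → ℝ := fun i => if i ∈ A then 1 else 0 with hf
  have hf01 : ∀ i j, |f j - f i| = f j + f i - 2 * (f i * f j) := fun i j => by
    simp only [hf]
    split_ifs <;> norm_num
  change ∑ i ∈ s, ∑ j ∈ s, |f j - f i| = _
  simp only [hf01, Finset.sum_sub_distrib, Finset.sum_add_distrib, Finset.sum_const,
    ← Finset.mul_sum, nsmul_eq_mul]
  rw [← Finset.sum_mul, hsum]
  ring

/-- Layer-cake argument: subtracting from `d` its least positive value `r` on its support `A`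
shrinks the support and lowers the pairwise distances by exactly `r` times the cut of `A`. The
inequality is thus a nonnegative combination of those for indicators. -/
theorem sum_mul_le_of_forall_subset_of_nonneg {α : Type*} [DecidableEq α] {s : Finset α}
    {g : α → ℝ} {lam : ℝ}
    (h : ∀ A ⊆ s, ∑ i ∈ A, g i ≤ lam * (A.card * ((s.card : ℝ) - A.card))) (d : α → ℝ)
    (hd : ∀ i ∈ s, 0 ≤ d i) :
    ∑ i ∈ s, g i * d i ≤ lam / 2 * ∑ i ∈ s, ∑ j ∈ s, |d j - d i| := by
  induction hN : (s.filter fun i => 0 < d i).card using Nat.strong_induction_on generalizing d with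
  | _ N ih =>
  set A := s.filter fun i => 0 < d i with hA
  have hAs : A ⊆ s := Finset.filter_subset _ _
  have hout : ∀ i ∈ s, i ∉ A → d i = 0 := fun i hi hiA => by
    refine le_antisymm (not_lt.1 fun hpos => hiA ?_) (hd i hi)
    exact Finset.mem_filter.2 ⟨hi, hpos⟩
  rcases A.eq_empty_or_nonempty with hAe | hAne
  · have hz : ∀ i ∈ s, d i = 0 := fun i hi => hout i hi (by simp [hAe])
    have e1 : ∑ i ∈ s, g i * d i = 0 := Finset.sum_eq_zero fun i hi => by rw [hz i hi, mul_zero]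
    have e2 : ∑ i ∈ s, ∑ j ∈ s, |d j - d i| = 0 := Finset.sum_eq_zero fun i hi =>
      Finset.sum_eq_zero fun j hj => by rw [hz i hi, hz j hj, sub_zero, abs_zero]
    rw [e1, e2, mul_zero]
  obtain ⟨i₀, hi₀, hmin⟩ := A.exists_min_image d hAne
  set r := d i₀ with hr
  have hrpos : 0 < r := (Finset.mem_filter.1 hi₀).2
  set f : α → ℝ := fun i => if i ∈ A then 1 else 0 with hf
  set d' : α → ℝ := fun i => d i - r * f i with hd'
  have hd'nn : ∀ i ∈ s, 0 ≤ d' i := fun i hi => by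
    by_cases hiA : i ∈ A
    · simp only [hd', hf, hiA, if_true]
      linarith [hmin i hiA]
    · simp only [hd', hf, hiA, if_false]
      linarith [hd i hi]
  have hcard : (s.filter fun i => 0 < d' i).card < N := by
    rw [← hN]
    refine Finset.card_lt_card ((Finset.ssubset_iff_of_subset fun i hi => ?_).2 ⟨i₀, hi₀, ?_⟩)
    · obtain ⟨his, hpos⟩ := Finset.mem_filter.1 hi
      by_contra hiA
      simp only [hd', hf, hiA, if_false, hout i his hiA] at hpos
      linarith
    · intro hi
      have hpos := (Finset.mem_filter.1 hi).2
      simp only [hd', hf, hi₀, if_true] at hpos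
      linarith
  have hI := ih _ hcard d' hd'nn rfl
  have e1 : ∑ i ∈ s, g i * d i = ∑ i ∈ s, g i * d' i + r * ∑ i ∈ A, g i := by
    have : ∑ i ∈ A, g i = ∑ i ∈ s, g i * f i := by
      simp only [hf, mul_ite, mul_one, mul_zero]
      rw [← Finset.sum_filter, Finset.filter_mem_eq_inter, Finset.inter_eq_right.2 hAs]
    rw [this, Finset.mul_sum, ← Finset.sum_add_distrib]
    exact Finset.sum_congr rfl fun i _ => by simp only [hd']; ring
  have e2 : ∑ i ∈ s, ∑ j ∈ s, |d j - d i|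
      = ∑ i ∈ s, ∑ j ∈ s, |d' j - d' i| + r * (2 * (A.card * ((s.card : ℝ) - A.card))) := by
    rw [← sum_sum_abs_indicator hAs, Finset.mul_sum, ← Finset.sum_add_distrib]
    refine Finset.sum_congr rfl fun i hi => ?_
    rw [Finset.mul_sum, ← Finset.sum_add_distrib]
    refine Finset.sum_congr rfl fun j hj => ?_
    by_cases hiA : i ∈ A <;> by_cases hjA : j ∈ A <;>
      simp only [hd', hf, hiA, hjA, if_true, if_false]
    · simp
    · rw [hout j hj hjA, abs_of_nonpos (by linarith [hd i hi]),
        abs_of_nonpos (by linarith [hmin i hiA])]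
      norm_num
    · rw [hout i hi hiA, abs_of_nonneg (by linarith [hd j hj]),
        abs_of_nonneg (by linarith [hmin j hjA])]
      norm_num
    · simp
  rw [e1, e2]
  have := mul_le_mul_of_nonneg_left (h A hAs) hrpos.le
  linarith

/-- The constants `±1` force the total to vanish and indicators give the subset bounds. Conversely,
a zero total permits shifting `d` by its minimum. -/
theorem forall_sum_mul_le_iff {α : Type*} [DecidableEq α] (s : Finset α) (g : α → ℝ) (lam : ℝ) :
    (∀ d : α → ℝ, ∑ i ∈ s, g i * d i ≤ lam / 2 * ∑ i ∈ s, ∑ j ∈ s, |d j - d i|) ↔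
      ∑ i ∈ s, g i = 0 ∧
        ∀ A ⊆ s, ∑ i ∈ A, g i ≤ lam * (A.card * ((s.card : ℝ) - A.card)) := by
  constructor
  · intro h
    refine ⟨le_antisymm ?_ ?_, fun A hA => ?_⟩
    · simpa using h fun _ => 1
    · simpa using h fun _ => -1
    · have h1 := h fun i => if i ∈ A then 1 else 0
      rw [sum_sum_abs_indicator hA] at h1
      simp only [mul_ite, mul_one, mul_zero] at h1
      rw [← Finset.sum_filter, Finset.filter_mem_eq_inter, Finset.inter_eq_right.2 hA] at h1
      linarith
  · rintro ⟨h0, hA⟩ d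
    rcases s.eq_empty_or_nonempty with rfl | hs
    · simp
    obtain ⟨i₀, hi₀, hmin⟩ := s.exists_min_image d hs
    have h1 := sum_mul_le_of_forall_subset_of_nonneg hA (fun i => d i - d i₀)
      fun i hi => sub_nonneg.2 (hmin i hi)
    have h2 : ∑ i ∈ s, g i * (d i - d i₀) = ∑ i ∈ s, g i * d i := by
      simp only [mul_sub, Finset.sum_sub_distrib]
      rw [← Finset.sum_mul, h0, zero_mul, sub_zero]
    simpa only [h2, sub_sub_sub_cancel_right] using h1

/-- After subtracting the minimum of `g` on `F`, terms outside `F` are nonpositive and those in `F`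
nonnegative; equal cardinalities cancel the shift. -/
theorem sum_le_sum_of_initial {α : Type*} [DecidableEq α] {s A F : Finset α} {g : α → ℝ}
    (hA : A ⊆ s) (hcard : A.card = F.card) (h : ∀ i ∈ F, ∀ j ∈ s, j ∉ F → g j ≤ g i) :
    ∑ i ∈ A, g i ≤ ∑ i ∈ F, g i := by
  rcases F.eq_empty_or_nonempty with rfl | hF
  · rw [Finset.card_empty, Finset.card_eq_zero] at hcard
    simp [hcard]
  obtain ⟨i₀, hi₀, hmin⟩ := F.exists_min_image g hF
  have h1 : ∑ i ∈ A, (g i - g i₀) ≤ ∑ i ∈ F, (g i - g i₀) := by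
    rw [← Finset.sum_inter_add_sum_sdiff A F]
    have hneg : ∑ i ∈ A \ F, (g i - g i₀) ≤ 0 := Finset.sum_nonpos fun i hi => by
      rw [Finset.mem_sdiff] at hi
      linarith [h i₀ hi₀ i (hA hi.1) hi.2]
    have hsub : ∑ i ∈ A ∩ F, (g i - g i₀) ≤ ∑ i ∈ F, (g i - g i₀) :=
      Finset.sum_le_sum_of_subset_of_nonneg Finset.inter_subset_right
        fun i hi _ => sub_nonneg.2 (hmin i hi)
    linarith
  simp only [Finset.sum_sub_distrib, Finset.sum_const, hcard] at h1
  linarith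

/-! ### Optimality conditions for a labelled partition -/

/-- The number of indices with a label above that of `i`, minus the number of those below. -/
noncomputable def labelWeight {n K : ℕ} (blk : Fin n → Fin K) (i : Fin n) : ℝ :=
  ((Finset.univ.filter fun j => blk i < blk j).card : ℝ)
    - (Finset.univ.filter fun j => blk j < blk i).card

/-- Between different clusters the sign of `B j - B i` is known, so the derivative is linear in `d`;
inside a cluster the kink leaves `|d j - d i|`. -/
theorem sum_sum_dirAbs {n K : ℕ} {blk : Fin n → Fin K} {B : Fin n → ℝ}
    (hlt : ∀ i j, blk i < blk j → B j < B i) (heq : ∀ i j, blk i = blk j → B i = B j)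
    (d : Fin n → ℝ) :
    ∑ i, ∑ j, dirAbs (B j - B i) (d j - d i)
      = 2 * ∑ i, labelWeight blk i * d i
        + ∑ i, ∑ j, if blk i = blk j then |d j - d i| else 0 := by
  have h1 : ∀ i j, dirAbs (B j - B i) (d j - d i)
      = ((if blk i < blk j then d i else 0) - (if blk j < blk i then d i else 0))
        + ((if blk j < blk i then d j else 0) - (if blk i < blk j then d j else 0))
        + (if blk i = blk j then |d j - d i| else 0) := by
    intro i j
    unfold dirAbs
    rcases lt_trichotomy (blk i) (blk j) with h | h | h
    · have := hlt i j h
      simp only [h, h.not_gt, h.ne, if_true, if_false]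
      rw [if_neg (by linarith), if_pos (by linarith)]
      ring
    · have := heq i j h
      simp [h, this]
    · have := hlt j i h
      simp only [h, h.not_gt, h.ne', if_true, if_false]
      rw [if_pos (by linarith)]
      ring
  have h2 : ∑ i, ∑ j, ((if blk i < blk j then d i else 0) - (if blk j < blk i then d i else 0))
      = ∑ i, labelWeight blk i * d i := by
    refine Finset.sum_congr rfl fun i _ => ?_
    rw [Finset.sum_sub_distrib, ← Finset.sum_filter, ← Finset.sum_filter]
    simp only [Finset.sum_const, nsmul_eq_mul, labelWeight]
    ring
  have h3 : ∑ i, ∑ j, ((if blk j < blk i then d j else 0) - (if blk i < blk j then d j else 0))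
      = ∑ i, labelWeight blk i * d i := by
    rw [Finset.sum_comm]
    exact h2
  simp only [h1]
  simp only [Finset.sum_add_distrib] at h2 h3 ⊢
  rw [h2, h3]
  ring

theorem sum_sum_same_label {n K : ℕ} (blk : Fin n → Fin K) (d : Fin n → ℝ) :
    (∑ i, ∑ j, if blk i = blk j then |d j - d i| else 0)
      = ∑ k, ∑ i with blk i = k, ∑ j with blk j = k, |d j - d i| := by
  rw [← Finset.sum_fiberwise Finset.univ blk]
  refine Finset.sum_congr rfl fun k _ => Finset.sum_congr rfl fun i hi => ?_
  rw [Finset.mem_filter] at hi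
  rw [Finset.sum_filter]
  exact Finset.sum_congr rfl fun j _ => by rw [hi.2]; simp only [eq_comm]

/-- The derivative is a sum over clusters of terms depending only on `d` there, so testing
directions supported on one cluster decouples the conditions. -/
theorem isSolution_iff_label {n K : ℕ} {lam : ℝ} (hlam : 0 < lam) {x B : Fin n → ℝ}
    {blk : Fin n → Fin K} (hlt : ∀ i j, blk i < blk j → B j < B i)
    (heq : ∀ i j, blk i = blk j → B i = B j) :
    IsSolution lam x B ↔ ∀ k,
      ∑ i with blk i = k, (x i - B i - lam * labelWeight blk i) = 0 ∧
        ∀ A ⊆ Finset.univ.filter fun i => blk i = k,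
          ∑ i ∈ A, (x i - B i - lam * labelWeight blk i)
            ≤ lam * (A.card * (((Finset.univ.filter fun i => blk i = k).card : ℝ) - A.card)) := by
  simp only [← forall_sum_mul_le_iff]
  rw [isSolution_iff_dirAbs hlam]
  set g : Fin n → ℝ := fun i => x i - B i - lam * labelWeight blk i with hg
  have key : ∀ d : Fin n → ℝ,
      (0 ≤ ∑ i, (B i - x i) * d i + lam / 2 * ∑ i, ∑ j, dirAbs (B j - B i) (d j - d i)) ↔
        ∑ k, ∑ i with blk i = k, g i * d i
          ≤ lam / 2 * ∑ k, ∑ i with blk i = k, ∑ j with blk j = k, |d j - d i| := by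
    intro d
    rw [sum_sum_dirAbs hlt heq, sum_sum_same_label, Finset.sum_fiberwise]
    have : ∑ i, g i * d i
        = -∑ i, (B i - x i) * d i - lam * ∑ i, labelWeight blk i * d i := by
      rw [Finset.mul_sum, ← Finset.sum_neg_distrib, ← Finset.sum_sub_distrib]
      exact Finset.sum_congr rfl fun i _ => by simp only [hg]; ring
    rw [this]
    constructor <;> intro h <;> linarith
  simp only [key]
  constructor
  · intro h k d
    have h1 := h fun i => if blk i = k then d i else 0
    rw [Fintype.sum_eq_single k, Fintype.sum_eq_single k] at h1
    · have e1 : ∑ i with blk i = k, g i * (if blk i = k then d i else 0)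
          = ∑ i with blk i = k, g i * d i :=
        Finset.sum_congr rfl fun i hi => by rw [if_pos (Finset.mem_filter.1 hi).2]
      have e2 : ∑ i with blk i = k, ∑ j with blk j = k,
          |(if blk j = k then d j else 0) - (if blk i = k then d i else 0)|
          = ∑ i with blk i = k, ∑ j with blk j = k, |d j - d i| :=
        Finset.sum_congr rfl fun i hi => Finset.sum_congr rfl fun j hj => by
          rw [if_pos (Finset.mem_filter.1 hi).2, if_pos (Finset.mem_filter.1 hj).2]
      rwa [e1, e2] at h1
    · intro k' hk'
      refine Finset.sum_eq_zero fun i hi => Finset.sum_eq_zero fun j hj => ?_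
      rw [if_neg (by rw [(Finset.mem_filter.1 hj).2]; exact hk'),
        if_neg (by rw [(Finset.mem_filter.1 hi).2]; exact hk'), sub_zero, abs_zero]
    · intro k' hk'
      refine Finset.sum_eq_zero fun i hi => ?_
      rw [if_neg (by rw [(Finset.mem_filter.1 hi).2]; exact hk'), mul_zero]
  · intro h d
    rw [Finset.mul_sum]
    exact Finset.sum_le_sum fun k _ => h k d

/-! ### The clusters of a sequence of right-limits -/

/-- `blk l` is the index of the cluster of position `l`. -/
def IsLabel {n K : ℕ} (t : Fin (K + 1) → ℕ) (blk : Fin n → Fin K) : Prop :=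
  ∀ l k, blk l = k ↔ t k.castSucc ≤ l ∧ (l : ℕ) < t k.succ

theorem exists_isLabel {n K : ℕ} {t : Fin (K + 1) → ℕ} (ht : t ∈ rightLimits K n) :
    ∃ blk : Fin n → Fin K, IsLabel t blk := by
  obtain ⟨h0, hmono, hlast⟩ := ht
  have hex : ∀ (l : Fin n) (i : Fin (K + 1)), (l : ℕ) < t i →
      ∃ k : Fin K, t k.castSucc ≤ l ∧ (l : ℕ) < t k.succ := by
    intro l i
    induction i using Fin.induction with
    | zero => intro h; omega
    | succ k ih =>
      intro h
      by_cases hk : t k.castSucc ≤ l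
      · exact ⟨k, hk, h⟩
      · exact ih (not_le.1 hk)
  have hex' : ∀ l : Fin n, ∃ k : Fin K, t k.castSucc ≤ l ∧ (l : ℕ) < t k.succ := fun l =>
    hex l (Fin.last K) (by rw [hlast]; exact l.2)
  choose blk hblk using hex'
  have hlt : ∀ (l : Fin n) (k k' : Fin K), k < k' → t k'.castSucc ≤ l → (l : ℕ) < t k.succ →
      False := by
    intro l k k' hkk h1 h2
    have : t k.succ ≤ t k'.castSucc := hmono.monotone (by
      rw [Fin.le_def]
      exact hkk)
    omega
  refine ⟨blk, fun l k => ⟨fun h => h ▸ hblk l, fun h => ?_⟩⟩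
  rcases lt_trichotomy (blk l) k with hk | hk | hk
  · exact (hlt l _ _ hk h.1 (hblk l).2).elim
  · exact hk
  · exact (hlt l _ _ hk (hblk l).1 h.2).elim

theorem card_window {n a b : ℕ} (hb : b ≤ n) :
    (Finset.univ.filter fun l : Fin n => a ≤ l ∧ (l : ℕ) < b).card = b - a := by
  rw [← Nat.card_Ico, ← Finset.card_map Fin.valEmbedding]
  congr 1
  ext x
  simp only [Finset.mem_map, Finset.mem_filter, Finset.mem_univ, true_and, Fin.valEmbedding_apply,
    Finset.mem_Ico]
  constructor
  · rintro ⟨l, h, rfl⟩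
    exact h
  · intro h
    exact ⟨⟨x, by omega⟩, h, rfl⟩

namespace IsLabel

variable {n K : ℕ} {t : Fin (K + 1) → ℕ} {blk : Fin n → Fin K}

theorem filter_eq (h : IsLabel t blk) (k : Fin K) :
    (Finset.univ.filter fun l => blk l = k)
      = Finset.univ.filter fun l : Fin n => t k.castSucc ≤ l ∧ (l : ℕ) < t k.succ :=
  Finset.filter_congr fun l _ => h l k

theorem le_card (ht : t ∈ rightLimits K n) (i : Fin (K + 1)) : t i ≤ n := by
  rw [← ht.2.2]
  exact ht.2.1.monotone (Fin.le_last i)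

theorem card_eq (h : IsLabel t blk) (ht : t ∈ rightLimits K n) (k : Fin K) :
    (Finset.univ.filter fun l => blk l = k).card = clusterCard t k := by
  rw [h.filter_eq, card_window (le_card ht _)]
  rfl

theorem lt_iff (h : IsLabel t blk) (ht : t ∈ rightLimits K n) (k : Fin K) (l : Fin n) :
    k < blk l ↔ t k.succ ≤ l := by
  have hl := (h l _).1 rfl
  constructor
  · intro hk
    refine le_trans (ht.2.1.monotone ?_) hl.1
    rw [Fin.le_def]
    exact hk
  · intro hk
    by_contra hn
    have : t (blk l).succ ≤ t k.succ := ht.2.1.monotone (Fin.succ_le_succ_iff.2 (not_lt.1 hn))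
    omega

theorem lt_iff' (h : IsLabel t blk) (ht : t ∈ rightLimits K n) (k : Fin K) (l : Fin n) :
    blk l < k ↔ (l : ℕ) < t k.castSucc := by
  have hl := (h l _).1 rfl
  constructor
  · intro hk
    refine lt_of_lt_of_le hl.2 (ht.2.1.monotone ?_)
    rw [Fin.le_def]
    exact hk
  · intro hk
    by_contra hn
    have : t k.castSucc ≤ t (blk l).castSucc :=
      ht.2.1.monotone (Fin.castSucc_le_castSucc_iff.2 (not_lt.1 hn))
    omega

theorem labelWeight_eq (h : IsLabel t blk) (ht : t ∈ rightLimits K n) (l : Fin n) :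
    labelWeight blk l = (n : ℝ) - t (blk l).succ - t (blk l).castSucc := by
  have h1 : (Finset.univ.filter fun j => blk l < blk j).card = n - t (blk l).succ := by
    rw [← card_window (a := t (blk l).succ) (le_refl n)]
    congr 1
    exact Finset.filter_congr fun j _ => (h.lt_iff ht _ j).trans (and_iff_left j.2).symm
  have h2 : (Finset.univ.filter fun j => blk j < blk l).card = t (blk l).castSucc := by
    rw [← Nat.sub_zero (t (blk l).castSucc), ← card_window (a := 0) (le_card ht _)]
    congr 1
    exact Finset.filter_congr fun j _ =>
      (h.lt_iff' ht _ j).trans (and_iff_right (Nat.zero_le _)).symm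
  rw [labelWeight, h1, h2, Nat.cast_sub (le_card ht _)]

theorem lt_of_label_lt (h : IsLabel t blk) (ht : t ∈ rightLimits K n) {l l' : Fin n}
    (hl : blk l < blk l') : l < l' := by
  have h1 := (h.lt_iff ht _ _).1 hl
  have h2 := ((h l _).1 rfl).2
  exact Fin.lt_def.2 (by omega)

theorem castSucc_lt_succ (ht : t ∈ rightLimits K n) (k : Fin K) : t k.castSucc < t k.succ :=
  ht.2.1 Fin.castSucc_lt_succ

theorem clusterCard_pos (ht : t ∈ rightLimits K n) (k : Fin K) : 0 < clusterCard t k :=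
  Nat.sub_pos_of_lt (castSucc_lt_succ ht k)

theorem surjective (h : IsLabel t blk) (ht : t ∈ rightLimits K n) : Function.Surjective blk := by
  intro k
  have h1 := castSucc_lt_succ ht k
  exact ⟨⟨t k.castSucc, lt_of_lt_of_le h1 (le_card ht _)⟩, (h _ _).2 ⟨le_rfl, h1⟩⟩

theorem cluster_eq (h : IsLabel t blk) (σ : Equiv.Perm (Fin n)) (k : Fin K) :
    cluster t σ k = {i | blk (σ.symm i) = k} := by
  ext i
  constructor
  · rintro ⟨l, h1, h2, rfl⟩
    simpa using (h l k).2 ⟨h1, h2⟩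
  · intro hi
    obtain ⟨h1, h2⟩ := (h _ _).1 hi
    exact ⟨σ.symm i, h1, h2, by simp⟩

/-- Turns equality of unlabelled partitions into a pattern of ties. Surjectivity of `blk` is needed:
no cluster is empty. -/
theorem clusteringOf_eq_iff (h : IsLabel t blk) (ht : t ∈ rightLimits K n)
    (σ : Equiv.Perm (Fin n)) (B : Fin n → ℝ) :
    clusteringOf B = clusteringOfOrder t σ ↔
      ∀ l l', B (σ l) = B (σ l') ↔ blk l = blk l' := by
  have hc := h.cluster_eq σ
  unfold clusteringOf clusteringOfOrder
  constructor
  · intro he l l'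
    obtain ⟨k, hk⟩ : {i | B i = B (σ l')} ∈ Set.range (cluster t σ) := he ▸ ⟨σ l', rfl⟩
    rw [hc] at hk
    have h1 := Set.ext_iff.1 hk (σ l')
    have h2 := Set.ext_iff.1 hk (σ l)
    simp only [Set.mem_ofPred_eq, Equiv.symm_apply_apply, iff_true] at h1 h2
    rw [← h2, h1]
  · intro hB
    have h1 : ∀ l, {i | B i = B (σ l)} = cluster t σ (blk l) := fun l => by
      rw [hc]
      ext i
      simpa using hB (σ.symm i) l
    apply Set.Subset.antisymm
    · rintro _ ⟨i, rfl⟩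
      refine ⟨blk (σ.symm i), ?_⟩
      rw [← h1]
      simp
    · rintro _ ⟨k, rfl⟩
      obtain ⟨l, rfl⟩ := h.surjective ht k
      exact ⟨σ l, h1 l⟩

theorem M₂_mulVec (h : IsLabel t blk) (u : Fin n → ℝ) (k : Fin (K - 1)) :
    (M₂ n t *ᵥ u) k
      = -(1 / (clusterCard t ⟨k, by omega⟩ : ℝ) * ∑ l with blk l = ⟨k, by omega⟩, u l)
        + 1 / (clusterCard t ⟨k + 1, by omega⟩ : ℝ) * ∑ l with blk l = ⟨k + 1, by omega⟩, u l := by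
  have he : ∀ l, M₂ n t k l = if blk l = ⟨k, by omega⟩ then
      -(1 / (clusterCard t ⟨k, by omega⟩ : ℝ)) else if blk l = ⟨k + 1, by omega⟩ then
      1 / (clusterCard t ⟨k + 1, by omega⟩ : ℝ) else 0 := fun l => by
    simp only [h l]
    rfl
  rw [Matrix.mulVec, dotProduct, Finset.sum_filter, Finset.sum_filter, Finset.mul_sum,
    Finset.mul_sum, ← Finset.sum_neg_distrib, ← Finset.sum_add_distrib]
  refine Finset.sum_congr rfl fun l _ => ?_
  rw [he]
  by_cases h1 : blk l = ⟨k, by omega⟩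
  · have h2 : ¬ blk l = ⟨k + 1, by omega⟩ := by
      rw [h1, Fin.mk.injEq]
      omega
    rw [if_pos h1, if_pos h1, if_neg h2]
    ring
  · rw [if_neg h1, if_neg h1]
    split_ifs <;> ring

theorem M₃_mulVec (h : IsLabel t blk) (u : Fin n → ℝ)
    (r : Σ k : Fin K, Fin (clusterCard t k - 1)) :
    (M₃ n t *ᵥ u) r
      = 1 / ((r.2 : ℝ) + 1) * ∑ l ∈ Finset.univ.filter fun l : Fin n =>
          t r.1.castSucc ≤ l ∧ (l : ℕ) < t r.1.castSucc + (r.2 + 1), u l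
        - 1 / (clusterCard t r.1 : ℝ) * ∑ l with blk l = r.1, u l := by
  rw [Matrix.mulVec, dotProduct, Finset.sum_filter, Finset.sum_filter, Finset.mul_sum,
    Finset.mul_sum, ← Finset.sum_sub_distrib]
  refine Finset.sum_congr rfl fun l _ => ?_
  simp only [h l, M₃, Matrix.of_apply, sub_mul, ite_mul, zero_mul, mul_ite, mul_zero]

end IsLabel

theorem M₁_mulVec {n : ℕ} (u : Fin n → ℝ) (r : Fin (n - 1)) :
    (M₁ n *ᵥ u) r = -u ⟨r, by omega⟩ + u ⟨r + 1, by omega⟩ := by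
  have he : ∀ l, M₁ n r l * u l = (if l = ⟨r, by omega⟩ then -u l else 0)
      + (if l = ⟨r + 1, by omega⟩ then u l else 0) := fun l => by
    simp only [M₁, Matrix.of_apply, Fin.ext_iff]
    split_ifs <;> first | omega | ring
  rw [Matrix.mulVec, dotProduct]
  simp only [he, Finset.sum_add_distrib, Finset.sum_ite_eq', Finset.mem_univ, if_true]

theorem antitone_iff_M₁_mulVec {n : ℕ} (u : Fin n → ℝ) :
    Antitone u ↔ ∀ r, (M₁ n *ᵥ u) r ≤ 0 := by
  cases n with
  | zero => exact iff_of_true (fun i => i.elim0) fun r => r.elim0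
  | succ n =>
    rw [Fin.antitone_iff_succ_le]
    refine forall_congr' fun r => ?_
    rw [M₁_mulVec]
    have : u r.succ ≤ u r.castSucc ↔ -u r.castSucc + u r.succ ≤ 0 := by
      constructor <;> intro h <;> linarith
    exact this

theorem m₂_eq {K : ℕ} (t : Fin (K + 1) → ℕ) (k : Fin (K - 1)) :
    m₂ t k = -((t (Fin.succ (⟨k + 1, by omega⟩ : Fin K)) : ℝ)
      - t (Fin.castSucc (⟨k, by omega⟩ : Fin K))) := rfl

/-! ### The conditioning event of one variable is a polyhedron up to its boundary -/

theorem mulVec_le_of_clusteringOf_eq {n K : ℕ} {lam : ℝ} (hlam : 0 < lam)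
    {t : Fin (K + 1) → ℕ} (ht : t ∈ rightLimits K n) {σ : Equiv.Perm (Fin n)} {x : Fin n → ℝ}
    (hx : clusteringOf (solution lam x) = clusteringOfOrder t σ) (hanti : Antitone (x ∘ σ))
    (r : Row n t) : (M n t *ᵥ (x ∘ σ)) r ≤ lam * m n t r := by
  obtain ⟨blk, hblk⟩ := exists_isLabel ht
  rw [hblk.clusteringOf_eq_iff ht] at hx
  have hsol := solution_spec hlam (x ∘ σ)
  rw [solution_comp_perm hlam] at hsol
  set u := x ∘ σ with hu
  set C := solution lam x ∘ σ with hC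
  -- The solution is ordered like the data, so the clusters carry strictly decreasing values.
  have hCanti : Antitone C := fun l l' hll => by
    by_contra hlt
    have := hsol.lt_of_lt hlam (not_le.1 hlt)
    exact absurd (hanti hll) (not_le.2 this)
  have heq : ∀ i j, blk i = blk j → C i = C j := fun i j hij => (hx i j).2 hij
  have hlt : ∀ i j, blk i < blk j → C j < C i := fun i j hij =>
    lt_of_le_of_ne (hCanti (hblk.lt_of_label_lt ht hij).le) fun he =>
      hij.ne' ((hx j i).1 he)
  have hopt := (isSolution_iff_label hlam hlt heq).1 hsol
  -- The zero-total condition, solved for the mean of the cluster.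
  have hmean : ∀ l, 1 / (clusterCard t (blk l) : ℝ) * ∑ i with blk i = blk l, u i
      = C l + lam * (n - t (blk l).succ - t (blk l).castSucc) := fun l => by
    have h1 := (hopt (blk l)).1
    have h2 : ∑ i with blk i = blk l, (u i - C i - lam * labelWeight blk i)
        = ∑ i with blk i = blk l, u i
          - clusterCard t (blk l) * (C l + lam * (n - t (blk l).succ - t (blk l).castSucc)) := by
      rw [← hblk.card_eq ht, ← nsmul_eq_mul, ← Finset.sum_const, ← Finset.sum_sub_distrib]
      refine Finset.sum_congr rfl fun i hi => ?_
      have hi' := (Finset.mem_filter.1 hi).2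
      rw [hblk.labelWeight_eq ht, heq i l hi', hi']
      ring
    have h3 : (0 : ℝ) < clusterCard t (blk l) := by exact_mod_cast IsLabel.clusterCard_pos ht _
    rw [h2] at h1
    rw [sub_eq_zero.1 h1]
    field_simp
  rcases r with r | k | r
  · simpa [M, m] using (antitone_iff_M₁_mulVec u).1 hanti r
  · change (M₂ n t *ᵥ u) k ≤ lam * m₂ t k
    obtain ⟨l, hl⟩ := hblk.surjective ht ⟨k, by omega⟩
    obtain ⟨l', hl'⟩ := hblk.surjective ht ⟨k + 1, by omega⟩
    have hv : C l' < C l := hlt l l' (by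
      rw [hl, hl', Fin.lt_def]
      exact Nat.lt_succ_self _)
    have h1 := hmean l
    have h2 := hmean l'
    rw [hl] at h1
    rw [hl'] at h2
    rw [hblk.M₂_mulVec, h1, h2, m₂_eq]
    have h3 : (t (Fin.succ (⟨k, by omega⟩ : Fin K)) : ℝ)
        = t (Fin.castSucc (⟨k + 1, by omega⟩ : Fin K)) := rfl
    rw [h3]
    linarith
  · change (M₃ n t *ᵥ u) r ≤ lam * m₃ t r
    rw [hblk.M₃_mulVec]
    obtain ⟨l, hl⟩ := hblk.surjective ht r.1
    have h1 := hmean l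
    rw [hl] at h1
    rw [h1]
    have hr := r.2.2
    have hcard : clusterCard t r.1 = t r.1.succ - t r.1.castSucc := rfl
    have hn := IsLabel.le_card ht r.1.succ
    set F : Finset (Fin n) := Finset.univ.filter fun l : Fin n =>
      t r.1.castSucc ≤ l ∧ (l : ℕ) < t r.1.castSucc + (r.2 + 1) with hF
    have hFcard : F.card = (r.2 : ℕ) + 1 := by
      rw [hF, card_window (by omega)]
      omega
    have hFs : F ⊆ Finset.univ.filter fun i => blk i = r.1 := by
      rw [hblk.filter_eq]
      intro i hi
      rw [hF, Finset.mem_filter] at hi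
      rw [Finset.mem_filter]
      refine ⟨hi.1, hi.2.1, ?_⟩
      omega
    have h2 := (hopt r.1).2 F hFs
    have h3 : ∑ i ∈ F, (u i - C i - lam * labelWeight blk i)
        = ∑ i ∈ F, u i - F.card * (C l + lam * (n - t r.1.succ - t r.1.castSucc)) := by
      rw [← nsmul_eq_mul, ← Finset.sum_const, ← Finset.sum_sub_distrib]
      refine Finset.sum_congr rfl fun i hi => ?_
      have hi' := (Finset.mem_filter.1 (hFs hi)).2
      rw [hblk.labelWeight_eq ht, heq i l (hi'.trans hl.symm), hi']
      ring
    rw [h3, hblk.card_eq ht, hFcard] at h2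
    push_cast at h2
    have hpos : (0 : ℝ) < (r.2 : ℝ) + 1 := by positivity
    rw [one_div, sub_le_iff_le_add, inv_mul_le_iff₀ hpos]
    simp only [m₃]
    linarith

/-- The inequalities certify an explicit candidate as optimal. Excluding equality in the `M₂` rows
keeps adjacent clusters from merging. -/
theorem clusteringOf_eq_of_mulVec_le {n K : ℕ} {lam : ℝ} (hlam : 0 < lam)
    {t : Fin (K + 1) → ℕ} (ht : t ∈ rightLimits K n) {σ : Equiv.Perm (Fin n)} {x : Fin n → ℝ}
    (hle : ∀ r : Row n t, (M n t *ᵥ (x ∘ σ)) r ≤ lam * m n t r)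
    (hne : ∀ k : Fin (K - 1), (M n t *ᵥ (x ∘ σ)) (.inr (.inl k)) ≠ lam * m n t (.inr (.inl k))) :
    clusteringOf (solution lam x) = clusteringOfOrder t σ ∧ Antitone (x ∘ σ) := by
  obtain ⟨blk, hblk⟩ := exists_isLabel ht
  set u := x ∘ σ with hu
  have hanti : Antitone u := (antitone_iff_M₁_mulVec u).2 fun r => by
    simpa [M, m] using hle (.inl r)
  refine ⟨?_, hanti⟩
  set mean : Fin K → ℝ := fun k => 1 / (clusterCard t k : ℝ) * ∑ i with blk i = k, u i with hmean
  -- The only cluster values compatible with the zero-total condition.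
  set v : Fin K → ℝ := fun k => mean k - lam * (n - t k.succ - t k.castSucc) with hv
  have hcpos : ∀ k, (0 : ℝ) < clusterCard t k := fun k => by
    exact_mod_cast IsLabel.clusterCard_pos ht k
  have hadj : ∀ k : Fin (K - 1), v ⟨k + 1, by omega⟩ < v ⟨k, by omega⟩ := fun k => by
    have h1 : (M₂ n t *ᵥ u) k < lam * m₂ t k :=
      lt_of_le_of_ne (hle (.inr (.inl k))) (hne k)
    rw [hblk.M₂_mulVec, m₂_eq] at h1
    have h3 : (t (Fin.succ (⟨k, by omega⟩ : Fin K)) : ℝ)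
        = t (Fin.castSucc (⟨k + 1, by omega⟩ : Fin K)) := rfl
    simp only [hv, hmean]
    rw [h3]
    linarith
  have hvanti : StrictAnti v := by
    clear_value v
    clear hv hmean mean hcpos hle hne hblk blk ht
    cases K with
    | zero => exact fun i => i.elim0
    | succ K => exact Fin.strictAnti_iff_succ_lt.2 hadj
  set C : Fin n → ℝ := fun l => v (blk l) with hC
  have hsol : IsSolution lam u C := by
    refine (isSolution_iff_label hlam (blk := blk) (fun i j hij => hvanti hij)
      fun i j hij => congrArg v hij).2 fun k => ?_
    have hg : ∀ A ⊆ Finset.univ.filter fun i => blk i = k,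
        ∑ i ∈ A, (u i - C i - lam * labelWeight blk i)
          = ∑ i ∈ A, u i - A.card * mean k := fun A hA => by
      rw [← nsmul_eq_mul, ← Finset.sum_const, ← Finset.sum_sub_distrib]
      refine Finset.sum_congr rfl fun i hi => ?_
      have hi' := (Finset.mem_filter.1 (hA hi)).2
      simp only [hblk.labelWeight_eq ht, hC, hv, hi']
      ring
    have htot : ∑ i with blk i = k, (u i - C i - lam * labelWeight blk i) = 0 := by
      rw [hg _ (Finset.Subset.refl _), hblk.card_eq ht, hmean]
      have := (hcpos k).ne'
      field_simp
      ring
    refine ⟨htot, fun A hA => ?_⟩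
    have hAle : A.card ≤ clusterCard t k := hblk.card_eq ht k ▸ Finset.card_le_card hA
    -- `M₃` only has rows for `1 ≤ ℓ ≤ n_k - 1`; the full and empty subsets are treated apart.
    rcases hAle.eq_or_lt with hAc | hAc
    · have hAs := Finset.eq_of_subset_of_card_le hA (by rw [hblk.card_eq ht, hAc])
      rw [hAs, htot]
      simp
    rcases A.eq_empty_or_nonempty with rfl | hAne
    · simp
    have hA0 := hAne.card_pos
    rw [hg A hA, hblk.card_eq ht]
    have hrow : (M₃ n t *ᵥ u) ⟨k, ⟨A.card - 1, by omega⟩⟩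
        ≤ lam * m₃ t ⟨k, ⟨A.card - 1, by omega⟩⟩ := hle (.inr (.inr _))
    rw [hblk.M₃_mulVec] at hrow
    simp only [m₃] at hrow
    have hsub : A.card - 1 + 1 = A.card := Nat.sub_add_cancel hA0
    have hcast : ((A.card - 1 : ℕ) : ℝ) + 1 = A.card := by exact_mod_cast hsub
    rw [hcast, hsub] at hrow
    set F : Finset (Fin n) := Finset.univ.filter fun l : Fin n =>
      t k.castSucc ≤ l ∧ (l : ℕ) < t k.castSucc + A.card with hF
    have hcard : clusterCard t k = t k.succ - t k.castSucc := rfl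
    have hn := IsLabel.le_card ht k.succ
    have hFcard : A.card = F.card := by
      rw [hF, card_window (by omega)]
      omega
    -- As `u` is sorted, the first `A.card` positions of the cluster maximize the sum.
    have hAF : ∑ i ∈ A, u i ≤ ∑ i ∈ F, u i := by
      refine sum_le_sum_of_initial hA hFcard fun i hi j hj hjF => hanti ?_
      rw [hblk.filter_eq, Finset.mem_filter] at hj
      rw [hF, Finset.mem_filter] at hi hjF
      rw [Fin.le_def]
      have : ¬ (j : ℕ) < t k.castSucc + A.card := fun h => hjF ⟨Finset.mem_univ _, hj.2.1, h⟩
      omega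
    have hApos : (0 : ℝ) < A.card := by exact_mod_cast hA0
    rw [one_div, sub_le_iff_le_add, inv_mul_le_iff₀ hApos] at hrow
    simp only [hmean]
    linarith
  have hCeq : solution lam x ∘ σ = C := by
    rw [← solution_comp_perm hlam]
    exact (solution_spec hlam _).unique hlam hsol
  rw [hblk.clusteringOf_eq_iff ht]
  intro l l'
  have h1 : solution lam x (σ l) = v (blk l) := congrFun hCeq l
  have h2 : solution lam x (σ l') = v (blk l') := congrFun hCeq l'
  rw [h1, h2]
  exact hvanti.injective.eq_iff

/-! ### The conditioning event is almost surely a polyhedron -/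

theorem stackedPerm_mulVec {n p : ℕ} (σ : Fin p → Equiv.Perm (Fin n))
    (y : Fin p × Fin n → ℝ) (c : Fin p × Fin n) :
    (stackedPerm σ *ᵥ y) c = y (c.1, σ c.1 c.2) := by
  rw [Matrix.mulVec, dotProduct, Fintype.sum_prod_type, Fintype.sum_eq_single c.1]
  · simp [stackedPerm]
  · intro j hj
    simp [stackedPerm, hj.symm]

theorem stacked_mulVec {n p : ℕ} {K : Fin p → ℕ} (t : ∀ j, Fin (K j + 1) → ℕ)
    (σ : Fin p → Equiv.Perm (Fin n)) (y : Fin p × Fin n → ℝ) (r : Σ j, Row n (t j)) :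
    ((stackedM n t * stackedPerm σ) *ᵥ y) r
      = (M n (t r.1) *ᵥ ((fun i => y (r.1, i)) ∘ σ r.1)) r.2 := by
  rw [← Matrix.mulVec_mulVec]
  generalize hz : stackedPerm σ *ᵥ y = z
  rw [Matrix.mulVec, dotProduct, Fintype.sum_prod_type, Fintype.sum_eq_single r.1]
  · simp only [stackedM, Matrix.of_apply, if_true, ← hz, stackedPerm_mulVec]
    rfl
  · intro j hj
    simp [stackedM, hj.symm]

theorem M₂_row_ne_zero {n K : ℕ} {t : Fin (K + 1) → ℕ} (ht : t ∈ rightLimits K n)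
    (k : Fin (K - 1)) : ∃ u : Fin n → ℝ, (M₂ n t *ᵥ u) k ≠ 0 := by
  obtain ⟨blk, hblk⟩ := exists_isLabel ht
  obtain ⟨l, hl⟩ := hblk.surjective ht ⟨k, by omega⟩
  refine ⟨Pi.single l 1, ?_⟩
  have hpos := IsLabel.clusterCard_pos ht ⟨k, by omega⟩
  have h := (hblk l _).1 hl
  rw [Matrix.mulVec_single_one]
  have : M₂ n t k l = -(1 / (clusterCard t ⟨k, by omega⟩ : ℝ)) := if_pos h
  rw [Matrix.col_apply, this]
  simpa using hpos.ne'

theorem ae_mem_conditioningSet_iff {n p : ℕ} {lam : ℝ} (hlam : 0 < lam)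
    {Γ : Matrix (Fin p × Fin n) (Fin p × Fin n) ℝ} (hΓ : Γ.PosDef)
    (β : EuclideanSpace ℝ (Fin p × Fin n)) (σ : Fin p → Equiv.Perm (Fin n))
    {K : Fin p → ℕ} {t : ∀ j, Fin (K j + 1) → ℕ} (ht : ∀ j, t j ∈ rightLimits (K j) n) :
    ∀ᵐ x ∂multivariateGaussian β Γ,
      (Matrix.of fun i j => x.ofLp (j, i)) ∈ conditioningSet lam t σ ↔
        ∀ r, ((stackedM n t * stackedPerm σ) *ᵥ x.ofLp) r ≤ (lam • stackedm n t) r := by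
  have hnull : ∀ᵐ x ∂multivariateGaussian β Γ, ∀ (j : Fin p) (k : Fin (K j - 1)),
      ((stackedM n t * stackedPerm σ) *ᵥ x.ofLp) ⟨j, .inr (.inl k)⟩
        ≠ (lam • stackedm n t) ⟨j, .inr (.inl k)⟩ := by
    rw [ae_all_iff]
    intro j
    rw [ae_all_iff]
    intro k
    rw [ae_iff]
    simp only [not_not]
    refine measure_hyperplane_multivariateGaussian hΓ β
      (a := (stackedM n t * stackedPerm σ) ⟨j, .inr (.inl k)⟩) (fun h0 => ?_) _
    obtain ⟨u, hu⟩ := M₂_row_ne_zero (ht j) k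
    -- A vector not annihilated by the `M₂` row is transported through `σ j`, so the stacked row is
    -- nonzero too.
    have h1 := stacked_mulVec t σ (fun c => u ((σ j).symm c.2)) ⟨j, .inr (.inl k)⟩
    have h2 : ((fun i => (fun c : Fin p × Fin n => u ((σ j).symm c.2)) (j, i)) ∘ σ j) = u := by
      ext i
      simp
    rw [Matrix.mulVec, h0, zero_dotProduct, h2] at h1
    exact hu h1.symm
  filter_upwards [hnull] with x hx
  simp only [stacked_mulVec] at hx ⊢
  constructor
  · intro h r
    exact mulVec_le_of_clusteringOf_eq hlam (ht r.1) (h r.1).1 (h r.1).2 r.2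
  · intro h j
    exact clusteringOf_eq_of_mulVec_le hlam (ht j) (fun r => h ⟨j, r⟩) (hx j)

end ConvexClustering

/-! ### Uniformity of the p-value given the clustering event -/

theorem mainTheorem5 {Ω : Type*} [MeasurableSpace Ω] (P : Measure Ω) [IsProbabilityMeasure P]
    (n p : ℕ)
    (β : Fin p × Fin n → ℝ) (Γ : Matrix (Fin p × Fin n) (Fin p × Fin n) ℝ)
    (hΓ : Γ.PosSemidef) (hΓ_inv : IsUnit Γ)
    (Y : Ω → Matrix (Fin n) (Fin p) ℝ)
    (hY : HasLaw (fun ω => WithLp.toLp 2 (Y ω).vec)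
      (multivariateGaussian (WithLp.toLp 2 β) Γ) P)
    (lam : ℝ) (hlam : 0 < lam)
    (σ : Fin p → Equiv.Perm (Fin n))
    (K : Fin p → ℕ) (hK : ∀ j, K j ∈ Finset.Icc 1 n)
    (t : ∀ j, Fin (K j + 1) → ℕ) (ht : ∀ j, t j ∈ ConvexClustering.rightLimits (K j) n)
    (κ : Fin p × Fin n → ℝ) (hκ : κ ≠ 0) (hκβ : κ ⬝ᵥ β = 0)
    (hE : P (Y ⁻¹' ConvexClustering.conditioningSet lam t σ) ≠ 0) :
    pdf.IsUniform (fun ω => ConvexClustering.pval lam Γ t σ κ (Y ω)) (Set.Icc (0 : ℝ) 1)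
      (P[|Y ⁻¹' ConvexClustering.conditioningSet lam t σ]) volume := by
  have hpd : Γ.PosDef := hΓ.posDef_iff_isUnit.2 hΓ_inv
  set X : Ω → EuclideanSpace ℝ (Fin p × Fin n) := fun ω => WithLp.toLp 2 (Y ω).vec with hX
  set G := multivariateGaussian (WithLp.toLp 2 β) Γ with hG
  set A := ConvexClustering.stackedM n t * ConvexClustering.stackedPerm σ with hA
  set b := lam • ConvexClustering.stackedm n t with hb
  set S : Set (EuclideanSpace ℝ (Fin p × Fin n)) := {x | ∀ r, (A *ᵥ x.ofLp) r ≤ b r} with hS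
  set f : EuclideanSpace ℝ (Fin p × Fin n) → ℝ := fun x =>
    ConvexClustering.polyhedralPValue A b Γ κ x.ofLp with hf
  have hfm : Measurable f :=
    (ConvexClustering.measurable_polyhedralPValue A b Γ κ).comp (by fun_prop)
  have hSm : MeasurableSet S := by
    have : S = ⋂ r, {x | (A *ᵥ x.ofLp) r ≤ b r} := by ext; simp [hS]
    rw [this]
    exact MeasurableSet.iInter fun r => measurableSet_le
      ((ConvexClustering.measurable_mulVec_apply A r).comp (by fun_prop)) measurable_const
  have hXm : AEMeasurable X P := hY.aemeasurable
  have hmap : P.map X = G := hY.map_eq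
  -- Measurability of the event is never needed: conditioning depends on it only up to a null set,
  -- so the preimage of the polyhedron replaces it.
  have hae : (Y ⁻¹' ConvexClustering.conditioningSet lam t σ : Set Ω) =ᵐ[P] X ⁻¹' S := by
    have h := ConvexClustering.ae_mem_conditioningSet_iff hlam hpd (WithLp.toLp 2 β) σ ht
    rw [← hG, ← hmap] at h
    filter_upwards [ae_of_ae_map hXm h] with ω hω
    exact propext hω
  have hcond : P[|Y ⁻¹' ConvexClustering.conditioningSet lam t σ] = P[|X ⁻¹' S] := by
    unfold ProbabilityTheory.cond
    rw [measure_congr hae, Measure.restrict_congr_set hae]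
  have hGS : P (X ⁻¹' S) = G S := by rw [← hmap, Measure.map_apply_of_aemeasurable hXm hSm]
  have hGS0 : G S ≠ 0 := by rwa [← hGS, ← measure_congr hae]
  have hXm' : AEMeasurable X (P[|X ⁻¹' S]) := hXm.mono_ac cond_absolutelyContinuous
  have hpval : (fun ω => ConvexClustering.pval lam Γ t σ κ (Y ω)) = f ∘ X := rfl
  unfold pdf.IsUniform
  rw [hcond, hpval]
  ext B hB
  have hfXm : AEMeasurable (f ∘ X) (P[|X ⁻¹' S]) := hfm.comp_aemeasurable hXm'
  rw [Measure.map_apply_of_aemeasurable hfXm hB, ProbabilityTheory.cond,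
    ProbabilityTheory.cond, Measure.smul_apply, Measure.smul_apply,
    Measure.restrict_apply₀' (hXm.nullMeasurableSet_preimage hSm), hGS, Set.preimage_comp,
    ← Set.preimage_inter, ← Measure.map_apply_of_aemeasurable hXm ((hfm hB).inter hSm), hmap,
    Set.inter_comm]
  have key := ConvexClustering.measure_polyhedron_inter_pvalue hpd β hκ hκβ A b hB
  have hset : S ∩ f ⁻¹' B = {x | (∀ r, (A *ᵥ x.ofLp) r ≤ b r) ∧
      ConvexClustering.polyhedralPValue A b Γ κ x.ofLp ∈ B} := rfl
  rw [hset, key, smul_eq_mul, ← mul_assoc, ENNReal.inv_mul_cancel hGS0 (measure_ne_top _ _),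
    one_mul, Real.volume_Icc]
  simp
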